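/- Let $(\Omega,\Sigma,\nu)$ be a $\sigma$-finite complete measure space and $L_0(\nu)$ the space of $\nu$-a.e. equivalence classes of real-valued measurable functions. A quasi Banach function space $Y=Y(\nu)$ is a linear subspace of $L_0(\nu)$ with a complete quasi norm $\|\cdot\|_Y$ such that: (I) if $x\in L_0(\nu)$, $y\in Y$ and $|x|\le|y|$, then $x\in Y$ and $\|x\|_Y\le\|y\|_Y$; (II) there is $0<t<\infty$ with $\|(|x|^t+|y|^t)^{1/t}\|_Y\le(\|x\|_Y^t+\|y\|_Y^t)^{1/t}$ for all $x,y\in Y$; (III) every measurable set that contains, up to null sets, the supports of all functions in $Y$ is $\Omega$ up to a null set, and $\|x_n\|_Y\to\|x\|_Y$ whenever $0\le x_n\in Y$, $x\in Y$ and $x_n\uparrow x$ $\nu$-a.e. Let $0<r<\infty$. The space $Y$ is $r$-concave if there is $c\ge0$ such that $\left(\sum_k\|x_k\|_Y^r\right)^{1/r}\le c\,\left\|\left(\sum_k|x_k|^r\right)^{1/r}\right\|_Y$ for all finite families $x_1,\dots,x_n\in Y$; the best such $c$ is denoted $M_{(r)}(Y)$. Let $E$ be a real quasi Banach space. A mapping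 $T:E\to Y$ is homogeneous if $T(\lambda x)=\lambda T(x)$ for all $\lambda\ge0$, $x\in E$; it is $r$-convex if there is $c\ge0$ such that $\left\|\left(\sum_k|Tx_k|^r\right)^{1/r}\right\|_Y\le c\left(\sum_k\|x_k\|_E^r\right)^{1/r}$ for all finite families $x_1,\dots,x_n\in E$; the best such $c$ is denoted $M^{(r)}(T)$. Let $T:E\to Y$ be homogeneous and $r$-convex, and let $Y$ be $r$-concave. Then there is a weight $0\le\omega\in L_0(\nu)$ such that $\omega^{1/r}y\in Y$ for all $y\in L_r(\nu)$, $$\sup_{\|y\|_{L_r(\nu)}\le1}\|\omega^{1/r}y\|_Y\le M^{(r)}(T)\,M_{(r)}(Y),$$ and $$\left(\int\frac{|Tx|^r}{\omega}\,d\nu\right)^{1/r}\le\|x\|_E\qquad\text{for all }x\in E,$$ where $0/0=0$ and $c/0=\infty$ for $c>0$. If moreover $T$ is linear and $1\le r<\infty$, then there are a function $0\le g\in L_0(\nu)$ for which the multiplication operator $M_g:L_r(\nu)\to Y$, $f\mapsto gf$, is well defined and bounded, and a bounded linear operator $R:E\to L_r(\nu)$ such that $T=M_gR$ and $\|M_g\|\,\|R\|\le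 M^{(r)}(T)\,M_{(r)}(Y)$. -/

import Mathlib

open MeasureTheory Filter Topology
open scoped ENNReal NNReal

/-- `q` is a quasi norm on the real vector space `E`. -/
structure IsQuasiNorm {E : Type*} [AddCommGroup E] [Module ℝ E] (q : E → ℝ) : Prop where
  nonneg : ∀ x, 0 ≤ q x
  eq_zero_iff : ∀ x, q x = 0 ↔ x = 0
  smul : ∀ (a : ℝ) (x : E), q (a • x) = |a| * q x
  add_le : ∃ K : ℝ, ∀ x y, q (x + y) ≤ K * (q x + q y)

/-- Every Cauchy sequence with respect to `q` converges with respect to `q`. -/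
def IsCompleteQuasiNorm {E : Type*} [AddCommGroup E] (q : E → ℝ) : Prop :=
  ∀ u : ℕ → E, (∀ ε : ℝ, 0 < ε → ∃ N, ∀ m, N ≤ m → ∀ n, N ≤ n → q (u m - u n) < ε) →
    ∃ x, Tendsto (fun n => q (u n - x)) atTop (𝓝 0)

/-- Boundedness of a mapping between quasi normed spaces `(E, p)` and `(F, q)`. -/
def IsBoundedOp {E F : Type*} (p : E → ℝ) (q : F → ℝ) (S : E → F) : Prop :=
  ∃ C : ℝ≥0, ∀ x, q (S x) ≤ C * p x

/-- The operator norm of a mapping between quasi normed spaces: the best constant `C` in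
`q (S x) ≤ C * p x` (and `∞` if there is none). -/
noncomputable def opQuasiNorm {E F : Type*} (p : E → ℝ) (q : F → ℝ) (S : E → F) : ℝ≥0∞ :=
  ⨅ (C : ℝ≥0) (_ : ∀ x, q (S x) ≤ C * p x), (C : ℝ≥0∞)

/-- For a space `X` of classes of measurable functions and a function `q` on `X`: the value
of `q` at the class of `f` if this class belongs to `X`, and `∞` if it does not. -/
noncomputable def extNorm {Ω : Type*} [MeasurableSpace Ω] {μ : Measure Ω}
    {X : Submodule ℝ (Ω →ₘ[μ] ℝ)} (q : X → ℝ) (f : Ω → ℝ) : ℝ≥0∞ :=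
  ⨅ (x : X) (_ : ⇑(x : Ω →ₘ[μ] ℝ) =ᵐ[μ] f), ENNReal.ofReal (q x)

/-- Quasi Köthe function spaces over `μ`. -/
structure QuasiKotheSpace {Ω : Type*} [MeasurableSpace Ω] (μ : Measure Ω) where
  /-- the underlying vector space of classes of measurable functions -/
  carrier : Submodule ℝ (Ω →ₘ[μ] ℝ)
  /-- the quasi norm -/
  qnorm : carrier → ℝ
  isQuasiNorm : IsQuasiNorm qnorm
  /-- (I): the lattice property -/
  solid : ∀ (x : Ω →ₘ[μ] ℝ) (y : carrier), |x| ≤ |(y : Ω →ₘ[μ] ℝ)| →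
    ∃ h : x ∈ carrier, qnorm ⟨x, h⟩ ≤ qnorm y
  /-- (II) -/
  exists_exponent : ∃ t : ℝ, 0 < t ∧ ∀ x y : carrier,
    extNorm qnorm (fun a => (|(x : Ω →ₘ[μ] ℝ) a| ^ t + |(y : Ω →ₘ[μ] ℝ) a| ^ t) ^ (1 / t)) ≤
      ENNReal.ofReal ((qnorm x ^ t + qnorm y ^ t) ^ (1 / t))
  /-- (III), first part: a measurable set that contains, up to null sets, the supports of all
  members of the space is all of `Ω` up to a null set -/
  full_support : ∀ A : Set Ω, MeasurableSet A →
    (∀ x : carrier, ∀ᵐ a ∂μ, (x : Ω →ₘ[μ] ℝ) a ≠ 0 → a ∈ A) → ∀ᵐ a ∂μ, a ∈ A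
  /-- (III), second part: the Fatou property -/
  fatou : ∀ (u : ℕ → carrier) (x : carrier),
    (∀ n, 0 ≤ (u n : Ω →ₘ[μ] ℝ)) →
    (∀ᵐ a ∂μ, Monotone (fun n => (u n : Ω →ₘ[μ] ℝ) a)) →
    (∀ᵐ a ∂μ, Tendsto (fun n => (u n : Ω →ₘ[μ] ℝ) a) atTop (𝓝 ((x : Ω →ₘ[μ] ℝ) a))) →
    Tendsto (fun n => qnorm (u n)) atTop (𝓝 (qnorm x))

namespace QuasiKotheSpace

variable {Ω : Type*} [MeasurableSpace Ω] {μ : Measure Ω}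

/-- A quasi Banach function space is a complete quasi Köthe function space. -/
def IsQuasiBanach (X : QuasiKotheSpace μ) : Prop :=
  IsCompleteQuasiNorm X.qnorm

/-- `(∑ ‖x k‖ ^ r) ^ (1 / r) ≤ c ‖(∑ |x k| ^ r) ^ (1 / r)‖` for all finite families in `X`. -/
def ConcaveWith (X : QuasiKotheSpace μ) (r : ℝ) (c : ℝ≥0) : Prop :=
  ∀ (n : ℕ) (x : Fin n → X.carrier),
    ENNReal.ofReal ((∑ k, X.qnorm (x k) ^ r) ^ (1 / r)) ≤
      c * extNorm X.qnorm (fun a => (∑ k, |(x k : Ω →ₘ[μ] ℝ) a| ^ r) ^ (1 / r))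

/-- `X` is `r`-concave. -/
def IsConcave (X : QuasiKotheSpace μ) (r : ℝ) : Prop :=
  ∃ c : ℝ≥0, X.ConcaveWith r c

/-- The best constant `M_(r)(X)` of `r`-concavity. -/
noncomputable def concavityConst (X : QuasiKotheSpace μ) (r : ℝ) : ℝ≥0∞ :=
  ⨅ (c : ℝ≥0) (_ : X.ConcaveWith r c), (c : ℝ≥0∞)

end QuasiKotheSpace

section Operators

variable {Ω : Type*} [MeasurableSpace Ω] {μ : Measure Ω} {E : Type*}

/-- `‖(∑ |T (x k)| ^ r) ^ (1 / r)‖ ≤ c (∑ ‖x k‖ ^ r) ^ (1 / r)` for all finite families in the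
quasi normed space `(E, q)`. -/
def OpConvexWith (q : E → ℝ) (Y : QuasiKotheSpace μ) (T : E → Y.carrier) (r : ℝ) (c : ℝ≥0) :
    Prop :=
  ∀ (n : ℕ) (x : Fin n → E),
    extNorm Y.qnorm (fun a => (∑ k, |(T (x k) : Ω →ₘ[μ] ℝ) a| ^ r) ^ (1 / r)) ≤
      c * ENNReal.ofReal ((∑ k, q (x k) ^ r) ^ (1 / r))

/-- The mapping `T` is `r`-convex. -/
def OpIsConvex (q : E → ℝ) (Y : QuasiKotheSpace μ) (T : E → Y.carrier) (r : ℝ) : Prop :=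
  ∃ c : ℝ≥0, OpConvexWith q Y T r c

/-- The best constant `M^(r)(T)` of `r`-convexity. -/
noncomputable def opConvexityConst (q : E → ℝ) (Y : QuasiKotheSpace μ) (T : E → Y.carrier)
    (r : ℝ) : ℝ≥0∞ :=
  ⨅ (c : ℝ≥0) (_ : OpConvexWith q Y T r c), (c : ℝ≥0∞)

/-- Homogeneity: `T (l x) = l T x` for all `l ≥ 0`. -/
def IsHomogeneousOp {F : Type*} [AddCommGroup E] [Module ℝ E] [AddCommGroup F] [Module ℝ F]
    (T : E → F) : Prop :=
  ∀ (l : ℝ) (x : E), 0 ≤ l → T (l • x) = l • T x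

end Operators

/-! Put `ρ f = ‖|f|^(1/r)‖_Y ^ r` (`powNorm`). It is positively homogeneous, and `r`-concavity with
constant `d` says that `∑ ρ (w k) ≤ d^r ρ f` whenever `w k ≥ 0` and `∑ w k ≤ f`. The `r`-convexity
of `T` with constant `c` bounds `ρ (∑ |T x_k|^r)` by `c^r ∑ q(x_k)^r`. Together these show that `∑ ρ
(w k)` is at most `(c d)^r ∑ q(x_k)^r` whenever `∑ w k ≤ ∑ |T x_k|^r`.

This compatibility is what Hahn-Banach needs (`exists_linearMap_between`): there is a positive
linear functional `L` with `ρ w ≤ L w` for dominated `w ≥ 0` and `L (|T x|^r) ≤ (c d)^r q(x)^r`. No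
duality for `Y` enters, so neither local convexity nor a restriction on `r` is needed.

`L` may fail to be countably additive. Carathéodory's construction from `A ↦ L 1_A` gives a measure
`μ` with `∫ v dμ ≤ L v`, which keeps the upper bound. The lower bound survives because an integrable
simple function `φ` is an increasing limit of functions `u` with `L u ≤ ∫ φ dμ + ε`, and `ρ` has the
Fatou property (`exists_measure_between`). That property must also produce membership of the limit
in `Y`; `powNorm_fatou` gets this from completeness and concavity.

Finally `μ ≪ ν` has a density `φ` with values in `[0, ∞]`, nonzero a.e. because `Y` has full
support, and the weight is `(c d)^r / φ`. In the linear case, `T` factors as division by `ω^(1/r)`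
followed by multiplication by it. -/

/-! ### Hahn-Banach separation by a positive functional. -/

section Domination

variable {Ω : Type*} [MeasurableSpace Ω] {ν : Measure Ω}

/-- The measurable functions whose modulus is a.e. dominated by the first component of a pair
in the cone `D`. -/
def dominatedSubmodule (ν : Measure Ω) (D : PointedCone ℝ ((Ω → ℝ) × ℝ)) :
    Submodule ℝ (Ω → ℝ) where
  carrier := {v | Measurable v ∧ ∃ p ∈ D, ∀ᵐ a ∂ν, |v a| ≤ p.1 a}
  zero_mem' := ⟨measurable_const, 0, zero_mem D, by simp⟩
  add_mem' := by
    rintro u v ⟨hu, p, hp, hup⟩ ⟨hv, p', hp', hvp⟩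
    refine ⟨hu.add hv, p + p', add_mem hp hp', ?_⟩
    filter_upwards [hup, hvp] with a h1 h2
    exact (abs_add_le _ _).trans (add_le_add h1 h2)
  smul_mem' := by
    rintro c v ⟨hv, p, hp, hvp⟩
    refine ⟨hv.const_smul c, |c| • p, D.smul_mem (abs_nonneg c) hp, ?_⟩
    filter_upwards [hvp] with a h
    simpa [abs_mul] using mul_le_mul_of_nonneg_left h (abs_nonneg c)

/-- A homogeneous lower bound `ρ` and an upper bound given by a cone `D` of pairs
`(f, s)` can be separated by a linear functional. -/
theorem exists_linearMap_between (D : PointedCone ℝ ((Ω → ℝ) × ℝ)) (ρ : (Ω → ℝ) → ℝ≥0∞)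
    (hDm : ∀ p ∈ D, Measurable p.1) (hD0 : ∀ p ∈ D, 0 ≤ p.1)
    (hs0 : ∀ p ∈ D, 0 ≤ p.2)
    (hDρ : ∀ p ∈ D, ∀ l : List (Ω → ℝ), (∀ w ∈ l, Measurable w ∧ 0 ≤ w) → l.sum ≤ᵐ[ν] p.1 →
      (l.map ρ).sum ≤ ENNReal.ofReal p.2)
    (hρ : ∀ (c : ℝ) (w : Ω → ℝ), 0 ≤ c → Measurable w → 0 ≤ w →
      ρ (c • w) = ENNReal.ofReal c * ρ w) :
    ∃ L : (Ω → ℝ) →ₗ[ℝ] ℝ,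
      (∀ v ∈ dominatedSubmodule ν D, 0 ≤ᵐ[ν] v → 0 ≤ L v) ∧
      (∀ p ∈ D, L p.1 ≤ p.2) ∧
      (∀ w ∈ dominatedSubmodule ν D, 0 ≤ w → ρ w ≤ ENNReal.ofReal (L w)) := by
  set V := dominatedSubmodule ν D
  -- The upward closed cone generated by the sublinear bound `S v = inf (p.2 - ∑ ρ w)` over `p ∈ D`
  -- and lists `w ≥ 0` with `v + ∑ w ≤ p.1`. A functional with `L ≤ S` satisfies all three claims at
  -- once.
  let K : PointedCone ℝ (V × ℝ) :=
    { carrier := {z | ∃ p ∈ D, ∃ l : List (Ω → ℝ), (∀ w ∈ l, Measurable w ∧ 0 ≤ w) ∧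
        ((z.1 : Ω → ℝ) + l.sum ≤ᵐ[ν] p.1) ∧ p.2 - (l.map fun w => (ρ w).toReal).sum ≤ z.2}
      zero_mem' := ⟨0, zero_mem D, [], by simp, ae_of_all _ fun a => by simp, by simp⟩
      add_mem' := by
        rintro z z' ⟨p, hp, l, hl, h1, h2⟩ ⟨p', hp', l', hl', h1', h2'⟩
        refine ⟨p + p', add_mem hp hp', l ++ l', ?_, ?_, ?_⟩
        · intro w hw
          rcases List.mem_append.1 hw with h | h
          exacts [hl w h, hl' w h]
        · filter_upwards [h1, h1'] with a ha ha'
          simp only [Prod.fst_add, Submodule.coe_add, List.sum_append, Pi.add_apply] at *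
          linarith
        · simp only [Prod.snd_add, List.map_append, List.sum_append] at *
          linarith
      smul_mem' := by
        rintro c z ⟨p, hp, l, hl, h1, h2⟩
        refine ⟨c • p, D.smul_mem c.2 hp, l.map (c • ·), ?_, ?_, ?_⟩
        · intro w hw
          obtain ⟨u, hu, rfl⟩ := List.mem_map.1 hw
          exact ⟨(hl u hu).1.const_smul _, smul_nonneg c.2 (hl u hu).2⟩
        · rw [← List.smul_sum]
          filter_upwards [h1] with a ha
          have := mul_le_mul_of_nonneg_left ha c.2
          change (c : ℝ) * ((z.1 : Ω → ℝ) a) + (c : ℝ) * l.sum a ≤ (c : ℝ) * p.1 a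
          rw [← mul_add]
          exact this
        · have e : ((l.map (c • ·)).map fun w => (ρ w).toReal).sum
              = c * (l.map fun w => (ρ w).toReal).sum := by
            rw [List.map_map, ← List.sum_map_mul_left]
            congr 1
            refine List.map_congr_left fun w hw => ?_
            have := hρ c w c.2 (hl w hw).1 (hl w hw).2
            simp only [Function.comp]
            rw [show (c • w) = (c : ℝ) • w from rfl, this, ENNReal.toReal_mul, ENNReal.toReal_ofReal c.2]
          rw [e]
          have := mul_le_mul_of_nonneg_left h2 c.2
          change (c : ℝ) * p.2 - _ ≤ (c : ℝ) * z.2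
          have h3 : (c : ℝ) * (p.2 - (l.map fun w => (ρ w).toReal).sum) ≤ c * z.2 := this
          linarith }
  -- `toReal` sends `∞` to `0`, so real and extended sums are compared only where the latter is
  -- finite, as `hDρ` guarantees for dominated lists.
  have hsum : ∀ l : List (Ω → ℝ), (l.map ρ).sum ≠ ⊤ →
      ((l.map ρ).sum).toReal = (l.map fun w => (ρ w).toReal).sum := by
    intro l
    induction l with
    | nil => simp
    | cons w l ih =>
      intro h
      simp only [List.map_cons, List.sum_cons, ne_eq, ENNReal.add_eq_top, not_or] at h ⊢
      rw [ENNReal.toReal_add h.1 h.2, ih h.2]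
  have hne : ((0, 1) : V × ℝ) ≠ 0 := by simp
  -- The functional `(0, t) ↦ t` is nonnegative on `K` by `hDρ`, which amounts to `S 0 ≥ 0`. Every
  -- point can be raised into `K` along `(0, 1)`, because members of `V` are dominated by `D`. The
  -- extension has the form `g (v, t) = t - L v`.
  obtain ⟨g, hg1, hg2⟩ := riesz_extension K (LinearPMap.mkSpanSingleton (0, 1) (1 : ℝ) hne)
    (by
      rintro ⟨x, hx⟩ hxK
      obtain ⟨t, rfl⟩ := Submodule.mem_span_singleton.1 hx
      have := LinearPMap.mkSpanSingleton'_apply ((0, 1) : V × ℝ) (1 : ℝ) (σ := RingHom.id ℝ)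
        (by intro c hc; simpa using hc) t hx
      obtain ⟨p, hp, l, hl, h1, h2⟩ := hxK
      have h3 := hDρ p hp l hl (by simpa using h1)
      have h4 := ENNReal.toReal_mono ENNReal.ofReal_ne_top h3
      rw [hsum l (h3.trans_lt ENNReal.ofReal_lt_top).ne, ENNReal.toReal_ofReal (hs0 p hp)] at h4
      erw [this]
      simp at h2 ⊢
      linarith)
    (by
      rintro ⟨⟨v, hvm, p, hp, hvp⟩, t⟩
      refine ⟨⟨(p.2 - t) • (0, 1), Submodule.smul_mem _ _ (Submodule.mem_span_singleton_self _)⟩,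
        p, hp, [], by simp, ?_, ?_⟩
      · filter_upwards [hvp] with a ha
        simpa using (le_abs_self _).trans ha
      · simp)
  have hg01 : g (0, 1) = 1 := by
    have := hg1 ⟨(0, 1), Submodule.mem_span_singleton_self _⟩
    rw [this]
    exact LinearPMap.mkSpanSingleton_apply ℝ ℝ hne 1
  have hgt : ∀ t : ℝ, g (0, t) = t := by
    intro t
    have : ((0, t) : V × ℝ) = t • (0, 1) := by simp
    rw [this, map_smul, hg01]; simp
  obtain ⟨L, hL⟩ := LinearMap.exists_extend (p := V) (-(g ∘ₗ LinearMap.inl ℝ V ℝ))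
  have hLv : ∀ (v : V) (t : ℝ), g (v, t) = t - L v := by
    intro v t
    have h1 : L v = - g (v, 0) := by
      have := LinearMap.congr_fun hL v
      simpa using this
    have : ((v, t) : V × ℝ) = (v, 0) + (0, t) := by simp
    rw [this, map_add, hgt, h1]; ring
  refine ⟨L, ?_, ?_, ?_⟩
  · intro v hv h0
    have h1 : ((-⟨v, hv⟩, 0) : V × ℝ) ∈ K := by
      refine ⟨0, zero_mem D, [], by simp, ?_, by simp⟩
      filter_upwards [h0] with a ha
      simpa using ha
    have := hg2 _ h1
    rw [hLv] at this
    simpa using this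
  · intro p hp
    have hpV : p.1 ∈ V := ⟨hDm p hp, p, hp, ae_of_all _ fun a => (abs_of_nonneg (hD0 p hp a)).le⟩
    have h1 : ((⟨p.1, hpV⟩, p.2) : V × ℝ) ∈ K := ⟨p, hp, [], by simp, ae_of_all _ fun a => by simp, by simp⟩
    have := hg2 _ h1
    rw [hLv] at this
    simpa using this
  · intro w hw hw0
    have hwm := hw
    obtain ⟨hm, p, hp, hwp⟩ := hwm
    have hfin : ρ w ≠ ⊤ := by
      have := hDρ p hp [w] (by simpa using ⟨hm, hw0⟩)
        (by filter_upwards [hwp] with a ha; simpa using (le_abs_self _).trans ha)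
      simp at this
      exact (this.trans_lt ENNReal.ofReal_lt_top).ne
    have h1 : ((-⟨w, hw⟩, -(ρ w).toReal) : V × ℝ) ∈ K :=
      ⟨0, zero_mem D, [w], by simpa using ⟨hm, hw0⟩, ae_of_all _ fun a => by simp, by simp⟩
    have := hg2 _ h1
    rw [hLv] at this
    rw [← ENNReal.ofReal_toReal hfin]
    apply ENNReal.ofReal_le_ofReal
    have h2 : L (((-⟨w, hw⟩ : V) : Ω → ℝ)) = - L w := by simp
    linarith

end Domination

/-! ### From a positive functional to a measure. -/

section CountablyAdditivePart

variable {Ω : Type*} [MeasurableSpace Ω] {ν : Measure Ω}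

/-- A linear functional which is positive on a solid space `V` of measurable functions. -/
structure IsPositiveOn (ν : Measure Ω) (V : Submodule ℝ (Ω → ℝ)) (L : (Ω → ℝ) →ₗ[ℝ] ℝ) :
    Prop where
  measurable : ∀ v ∈ V, Measurable v
  solid : ∀ v ∈ V, ∀ u : Ω → ℝ, Measurable u → (∀ a, |u a| ≤ |v a|) → u ∈ V
  mem_of_ae_zero : ∀ u : Ω → ℝ, Measurable u → u =ᵐ[ν] 0 → u ∈ V
  nonneg : ∀ v ∈ V, 0 ≤ᵐ[ν] v → 0 ≤ L v

open Classical in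
/-- The value of a functional `L` at an indicator function in `V`, and `∞` if the indicator
function is not in `V`. -/
noncomputable def setValue (V : Submodule ℝ (Ω → ℝ)) (L : (Ω → ℝ) →ₗ[ℝ] ℝ) (A : Set Ω) : ℝ≥0∞ :=
  if A.indicator (1 : Ω → ℝ) ∈ V then ENNReal.ofReal (L (A.indicator 1)) else ∞

namespace IsPositiveOn

variable {V : Submodule ℝ (Ω → ℝ)} {L : (Ω → ℝ) →ₗ[ℝ] ℝ}

omit [MeasurableSpace Ω] in
theorem setValue_of_mem {A : Set Ω} (hA : A.indicator (1 : Ω → ℝ) ∈ V) :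
    setValue V L A = ENNReal.ofReal (L (A.indicator 1)) := if_pos hA

omit [MeasurableSpace Ω] in
theorem mem_of_setValue_ne_top {A : Set Ω} (hA : setValue V L A ≠ ∞) :
    A.indicator (1 : Ω → ℝ) ∈ V := by
  by_contra h
  exact hA (if_neg h)

omit [MeasurableSpace Ω] in
theorem setValue_empty : setValue V L ∅ = 0 := by
  rw [setValue_of_mem] <;> rw [Set.indicator_empty']
  · simp
  · exact zero_mem V

theorem mono (h : IsPositiveOn ν V L) {u v : Ω → ℝ} (hu : u ∈ V) (hv : v ∈ V) (huv : u ≤ v) :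
    L u ≤ L v := by
  have := h.nonneg _ (V.sub_mem hv hu) (ae_of_all _ fun a => sub_nonneg.2 (huv a))
  rw [map_sub] at this
  linarith

theorem measurableSet_of_mem (h : IsPositiveOn ν V L) {A : Set Ω}
    (hA : A.indicator (1 : Ω → ℝ) ∈ V) : MeasurableSet A :=
  (measurable_indicator_const_iff (1 : ℝ)).1 (h.measurable _ hA)

theorem indicator_mem (h : IsPositiveOn ν V L) {A B : Set Ω}
    (hA : A.indicator (1 : Ω → ℝ) ∈ V) (hB : MeasurableSet B) (hBA : B ⊆ A) :
    B.indicator (1 : Ω → ℝ) ∈ V := by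
  refine h.solid _ hA _ (measurable_one.indicator hB) fun a => ?_
  by_cases ha : a ∈ B
  · simp [ha, hBA ha]
  · simp [ha]

/-- This is the condition making every measurable set Carathéodory measurable for the outer measure
generated by `setValue`. Only the case `1_t ∈ V` has content; there it is additivity of `L`. -/
theorem setValue_inter_add_sdiff (h : IsPositiveOn ν V L) {s : Set Ω} (hs : MeasurableSet s)
    (t : Set Ω) : setValue V L (t ∩ s) + setValue V L (t \ s) ≤ setValue V L t := by
  by_cases ht : setValue V L t = ∞
  · simp [ht]
  have ht := mem_of_setValue_ne_top ht
  have htm := h.measurableSet_of_mem ht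
  have h1 := h.indicator_mem ht (htm.inter hs) Set.inter_subset_left
  have h2 := h.indicator_mem ht (htm.diff hs) Set.sdiff_subset
  rw [setValue_of_mem ht, setValue_of_mem h1, setValue_of_mem h2, ← ENNReal.ofReal_add, ← map_add]
  · apply le_of_eq
    congr 2
    ext a
    by_cases ha : a ∈ t <;> by_cases has : a ∈ s <;> simp [ha, has]
  · exact h.nonneg _ h1 (ae_of_all _ fun a => Set.indicator_nonneg (by simp) a)
  · exact h.nonneg _ h2 (ae_of_all _ fun a => Set.indicator_nonneg (by simp) a)

/-- The countably additive part of a positive functional. -/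
noncomputable def countablyAdditivePart (h : IsPositiveOn ν V L) : Measure Ω :=
  (OuterMeasure.ofFunction (setValue V L) setValue_empty).toMeasure fun s hs => by
    exact OuterMeasure.ofFunction_caratheodory (h.setValue_inter_add_sdiff hs)

theorem countablyAdditivePart_le (h : IsPositiveOn ν V L) {A : Set Ω} (hA : MeasurableSet A) :
    h.countablyAdditivePart A ≤ setValue V L A := by
  rw [countablyAdditivePart, toMeasure_apply _ _ hA]
  exact OuterMeasure.ofFunction_le _

/-- If `A` is null then `-1_A ≥ 0` a.e., so positivity in the a.e. sense forces `L 1_A ≤ 0`. -/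
theorem absolutelyContinuous (h : IsPositiveOn ν V L) : h.countablyAdditivePart ≪ ν := by
  refine Measure.AbsolutelyContinuous.mk fun A hA hA0 => ?_
  have hm : Measurable (A.indicator (1 : Ω → ℝ)) := measurable_one.indicator hA
  have h0 : A.indicator (1 : Ω → ℝ) =ᵐ[ν] 0 := by
    rw [Set.indicator_ae_eq_zero]
    exact measure_mono_null Set.inter_subset_left hA0
  have hV := h.mem_of_ae_zero _ hm h0
  refine le_antisymm ((h.countablyAdditivePart_le hA).trans ?_) zero_le
  have := h.nonneg _ (V.neg_mem hV) (by filter_upwards [h0] with a ha; simp [ha])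
  rw [map_neg] at this
  rw [setValue_of_mem hV, ENNReal.ofReal_of_nonpos (by linarith)]

theorem simpleFunc_lintegral_le (h : IsPositiveOn ν V L) (φ : SimpleFunc Ω ℝ≥0) :
    (fun a => (φ a : ℝ)) ∈ V →
      ∫⁻ a, φ a ∂h.countablyAdditivePart ≤ ENNReal.ofReal (L fun a => (φ a : ℝ)) := by
  induction φ using SimpleFunc.induction with
  | const c hs =>
    rename_i s
    intro hV
    rcases eq_or_ne c 0 with rfl | hc
    · simp
    have e : (fun a => ((SimpleFunc.piecewise s hs (SimpleFunc.const Ω c)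
        (SimpleFunc.const Ω 0) : SimpleFunc Ω ℝ≥0) a : ℝ)) = (c : ℝ) • s.indicator 1 := by
      ext a
      by_cases ha : a ∈ s <;> simp [ha]
    have e' : (fun a => ((SimpleFunc.piecewise s hs (SimpleFunc.const Ω c)
        (SimpleFunc.const Ω 0) : SimpleFunc Ω ℝ≥0) a : ℝ≥0∞)) = s.indicator fun _ => (c : ℝ≥0∞) := by
      ext a
      by_cases ha : a ∈ s <;> simp [ha]
    rw [e] at hV ⊢
    have hc' : (c : ℝ) ≠ 0 := by exact_mod_cast hc
    have hsV : s.indicator (1 : Ω → ℝ) ∈ V := by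
      have := V.smul_mem (c : ℝ)⁻¹ hV
      rwa [smul_smul, inv_mul_cancel₀ hc', one_smul] at this
    rw [e', lintegral_indicator_const hs, map_smul, smul_eq_mul, ENNReal.ofReal_mul c.coe_nonneg,
      ENNReal.ofReal_coe_nnreal]
    gcongr
    exact (h.countablyAdditivePart_le hs).trans (setValue_of_mem hsV).le
  | add _ hf hg =>
    rename_i f g _
    intro hV
    have hmf : Measurable fun a => (f a : ℝ) := f.measurable.coe_nnreal_real
    have hmg : Measurable fun a => (g a : ℝ) := g.measurable.coe_nnreal_real
    have h1 : (fun a => (f a : ℝ)) ∈ V := by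
      refine h.solid _ hV _ hmf fun a => ?_
      simp only [SimpleFunc.coe_add, Pi.add_apply, NNReal.coe_add, NNReal.abs_eq]
      rw [abs_of_nonneg (by positivity)]
      linarith [(g a).2]
    have h2 : (fun a => (g a : ℝ)) ∈ V := by
      refine h.solid _ hV _ hmg fun a => ?_
      simp only [SimpleFunc.coe_add, Pi.add_apply, NNReal.coe_add, NNReal.abs_eq]
      rw [abs_of_nonneg (by positivity)]
      linarith [(f a).2]
    have e : (fun a => ((f + g) a : ℝ)) = (fun a => (f a : ℝ)) + fun a => (g a : ℝ) := by
      ext a; simp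
    have e' : (fun a => ((f + g) a : ℝ≥0∞)) = fun a => (f a : ℝ≥0∞) + (g a : ℝ≥0∞) := by
      ext a; simp
    rw [e, e', map_add, ENNReal.ofReal_add
      (h.nonneg _ h1 (ae_of_all _ fun a => (f a).2)) (h.nonneg _ h2 (ae_of_all _ fun a => (g a).2)),
      lintegral_add_left f.measurable.coe_nnreal_ennreal]
    exact add_le_add (hf h1) (hg h2)

/-- The integral is a supremum over simple functions below `v`. These lie in `V` by solidity, and
for them the bound follows by additivity from the bound on sets. -/
theorem lintegral_le (h : IsPositiveOn ν V L) {v : Ω → ℝ} (hv : v ∈ V) (h0 : 0 ≤ v) :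
    ∫⁻ a, ENNReal.ofReal (v a) ∂h.countablyAdditivePart ≤ ENNReal.ofReal (L v) := by
  rw [lintegral_eq_nnreal]
  refine iSup₂_le fun φ hφ => ?_
  have hle : ∀ a, (φ a : ℝ) ≤ v a := fun a => by
    have := hφ a
    rwa [← ENNReal.ofReal_coe_nnreal, ENNReal.ofReal_le_ofReal_iff (h0 a)] at this
  have hV : (fun a => (φ a : ℝ)) ∈ V := by
    refine h.solid _ hv _ φ.measurable.coe_nnreal_real fun a => ?_
    rw [abs_of_nonneg (φ a).coe_nonneg, abs_of_nonneg (h0 a)]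
    exact hle a
  rw [← SimpleFunc.lintegral_eq_lintegral]
  exact (h.simpleFunc_lintegral_le φ hV).trans (ENNReal.ofReal_le_ofReal (h.mono hV hv hle))

/-- A set of finite measure is exhausted by sets on which the functional is almost given by the
measure. -/
theorem exists_approx_set (h : IsPositiveOn ν V L) {s : Set Ω} (hs : MeasurableSet s)
    (hfin : h.countablyAdditivePart s ≠ ∞) {ε : ℝ≥0∞} (hε : ε ≠ 0) :
    ∃ B : ℕ → Set Ω, Monotone B ∧ (⋃ k, B k) = s ∧
      ∀ k, (B k).indicator (1 : Ω → ℝ) ∈ V ∧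
        ENNReal.ofReal (L ((B k).indicator 1)) ≤ h.countablyAdditivePart s + ε := by
  -- The outer measure is an infimum over countable covers, so some cover `t n` has `∑ L 1_(t n) < μ
  -- s + ε`. The sets `B k` are the parts of `s` covered by its first `k` members.
  have h1 : (OuterMeasure.ofFunction (setValue V L) setValue_empty) s <
      h.countablyAdditivePart s + ε := by
    rw [← toMeasure_apply (OuterMeasure.ofFunction (setValue V L) setValue_empty)
      (fun s hs => by exact OuterMeasure.ofFunction_caratheodory (h.setValue_inter_add_sdiff hs))
      hs]
    exact ENNReal.lt_add_right hfin hε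
  rw [OuterMeasure.ofFunction_apply] at h1
  simp only [iInf_lt_iff] at h1
  obtain ⟨t, hst, ht⟩ := h1
  have htV : ∀ n, (t n).indicator (1 : Ω → ℝ) ∈ V := fun n =>
    mem_of_setValue_ne_top (ENNReal.ne_top_of_tsum_ne_top (ht.trans_le le_top).ne n)
  have htm : ∀ n, MeasurableSet (t n) := fun n => h.measurableSet_of_mem (htV n)
  have hUm : ∀ k : ℕ, MeasurableSet (⋃ n ∈ Finset.range k, t n) := fun k =>
    Finset.measurableSet_biUnion _ fun n _ => htm n
  have hle : ∀ k : ℕ, ∀ a, (s ∩ ⋃ n ∈ Finset.range k, t n).indicator (1 : Ω → ℝ) a ≤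
      (∑ n ∈ Finset.range k, (t n).indicator (1 : Ω → ℝ)) a := by
    intro k a
    rw [Finset.sum_apply]
    have hnn : ∀ n ∈ Finset.range k, 0 ≤ (t n).indicator (1 : Ω → ℝ) a := fun n _ =>
      Set.indicator_nonneg (by simp) a
    by_cases ha : a ∈ s ∩ ⋃ n ∈ Finset.range k, t n
    · rw [Set.indicator_of_mem ha]
      obtain ⟨n, hn, han⟩ := Set.mem_iUnion₂.1 ha.2
      refine le_trans ?_ (Finset.single_le_sum hnn hn)
      simp [han]
    · rw [Set.indicator_of_notMem ha]
      exact Finset.sum_nonneg hnn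
  have hsumV : ∀ k : ℕ, (∑ n ∈ Finset.range k, (t n).indicator (1 : Ω → ℝ)) ∈ V := fun k =>
    V.sum_mem fun n _ => htV n
  have hBV : ∀ k : ℕ, (s ∩ ⋃ n ∈ Finset.range k, t n).indicator (1 : Ω → ℝ) ∈ V := by
    intro k
    refine h.solid _ (hsumV k) _ (measurable_one.indicator (hs.inter (hUm k))) fun a => ?_
    rw [abs_of_nonneg (Set.indicator_nonneg (by simp) a)]
    exact (hle k a).trans (le_abs_self _)
  refine ⟨fun k => s ∩ ⋃ n ∈ Finset.range k, t n, ?_, ?_, fun k => ⟨hBV k, ?_⟩⟩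
  · intro k l hkl
    refine Set.inter_subset_inter_right _ (Set.biUnion_subset_biUnion_left fun n hn => ?_)
    exact Finset.range_mono hkl hn
  · rw [← Set.inter_iUnion]
    refine Set.inter_eq_left.2 fun a ha => ?_
    obtain ⟨n, hn⟩ := Set.mem_iUnion.1 (hst ha)
    exact Set.mem_iUnion.2 ⟨n + 1, Set.mem_iUnion₂.2 ⟨n, by simp, hn⟩⟩
  · refine le_trans (ENNReal.ofReal_le_ofReal (h.mono (hBV k) (hsumV k) (hle k))) ?_
    rw [map_sum, ENNReal.ofReal_sum_of_nonneg fun n _ => h.nonneg _ (htV n)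
      (ae_of_all _ fun a => Set.indicator_nonneg (by simp) a)]
    refine le_trans ?_ ht.le
    refine le_trans (le_of_eq ?_) (ENNReal.sum_le_tsum (Finset.range k))
    exact Finset.sum_congr rfl fun n _ => (setValue_of_mem (htV n)).symm

/-- An integrable simple function is an increasing limit of functions in `V` on which the
functional is almost bounded by the integral. -/
theorem exists_approx (h : IsPositiveOn ν V L) (φ : SimpleFunc Ω ℝ≥0) :
    ∫⁻ a, φ a ∂h.countablyAdditivePart ≠ ∞ → ∀ ε : ℝ≥0∞, ε ≠ 0 →
      ∃ u : ℕ → Ω → ℝ, Monotone u ∧ (∀ a, Tendsto (fun k => u k a) atTop (𝓝 (φ a))) ∧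
        ∀ k, u k ∈ V ∧ 0 ≤ u k ∧
          ENNReal.ofReal (L (u k)) ≤ ∫⁻ a, φ a ∂h.countablyAdditivePart + ε := by
  induction φ using SimpleFunc.induction with
  | const c hs =>
    rename_i s
    intro hfin ε hε
    rcases eq_or_ne c 0 with rfl | hc
    · exact ⟨0, monotone_const, by simp, fun k => ⟨zero_mem V, le_rfl, by simp⟩⟩
    have hc' : (c : ℝ≥0∞) ≠ 0 := by exact_mod_cast hc
    have e' : (fun a => ((SimpleFunc.piecewise s hs (SimpleFunc.const Ω c)
        (SimpleFunc.const Ω 0) : SimpleFunc Ω ℝ≥0) a : ℝ≥0∞)) = s.indicator fun _ => (c : ℝ≥0∞) := by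
      ext a
      by_cases ha : a ∈ s <;> simp [ha]
    rw [e', lintegral_indicator_const hs] at hfin ⊢
    have hs' : h.countablyAdditivePart s ≠ ∞ := fun H => hfin (by simp [H, hc])
    obtain ⟨B, hBm, hBU, hB⟩ := h.exists_approx_set hs hs' (ε := ε / c)
      (ENNReal.div_ne_zero.2 ⟨hε, ENNReal.coe_ne_top⟩)
    refine ⟨fun k => (c : ℝ) • (B k).indicator 1, ?_, ?_, fun k => ⟨V.smul_mem _ (hB k).1, ?_, ?_⟩⟩
    · intro k l hkl a
      refine mul_le_mul_of_nonneg_left ?_ c.2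
      exact Set.indicator_le_indicator_of_subset (hBm hkl) (by simp) a
    · intro a
      by_cases ha : a ∈ s
      · obtain ⟨n, hn⟩ := Set.mem_iUnion.1 (hBU ▸ ha)
        refine tendsto_const_nhds.congr' ?_
        filter_upwards [eventually_ge_atTop n] with k hk
        simp [ha, hBm hk hn]
      · have : ∀ k, a ∉ B k := fun k hk => ha (hBU ▸ Set.mem_iUnion.2 ⟨k, hk⟩)
        simp [ha, this]
    · exact smul_nonneg c.2 (Set.indicator_nonneg (by simp))
    · rw [map_smul, smul_eq_mul, ENNReal.ofReal_mul c.coe_nonneg, ENNReal.ofReal_coe_nnreal]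
      calc _ ≤ (c : ℝ≥0∞) * (h.countablyAdditivePart s + ε / c) := by gcongr; exact (hB k).2
        _ = _ := by rw [mul_add, ENNReal.mul_div_cancel hc' ENNReal.coe_ne_top]
  | add _ hf hg =>
    rename_i f g _
    intro hfin ε hε
    have e' : (fun a => ((f + g) a : ℝ≥0∞)) = fun a => (f a : ℝ≥0∞) + (g a : ℝ≥0∞) := by
      ext a; simp
    rw [e', lintegral_add_left f.measurable.coe_nnreal_ennreal] at hfin ⊢
    rw [ENNReal.add_ne_top] at hfin
    have hε2 : ε / 2 ≠ 0 := ENNReal.div_ne_zero.2 ⟨hε, by simp⟩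
    obtain ⟨u, hum, hut, hu⟩ := hf hfin.1 _ hε2
    obtain ⟨v, hvm, hvt, hv⟩ := hg hfin.2 _ hε2
    refine ⟨u + v, hum.add hvm, fun a => ?_, fun k => ⟨V.add_mem (hu k).1 (hv k).1,
      add_nonneg (hu k).2.1 (hv k).2.1, ?_⟩⟩
    · simpa using (hut a).add (hvt a)
    · rw [Pi.add_apply, map_add]
      refine ENNReal.ofReal_add_le.trans ((add_le_add (hu k).2.2 (hv k).2.2).trans (le_of_eq ?_))
      rw [add_add_add_comm, ENNReal.add_halves]

end IsPositiveOn

/-- A lower bound `ρ` with the Fatou property for which a cone `D` of pairs `(f, s)` provides upper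
bounds is separated from `D` by a measure. -/
theorem exists_measure_between (D : PointedCone ℝ ((Ω → ℝ) × ℝ)) (ρ : (Ω → ℝ) → ℝ≥0∞)
    (hDm : ∀ p ∈ D, Measurable p.1) (hD0 : ∀ p ∈ D, 0 ≤ p.1) (hs0 : ∀ p ∈ D, 0 ≤ p.2)
    (hDρ : ∀ p ∈ D, ∀ l : List (Ω → ℝ), (∀ w ∈ l, Measurable w ∧ 0 ≤ w) → l.sum ≤ᵐ[ν] p.1 →
      (l.map ρ).sum ≤ ENNReal.ofReal p.2)
    (hρ : ∀ (c : ℝ) (w : Ω → ℝ), 0 ≤ c → Measurable w → 0 ≤ w →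
      ρ (c • w) = ENNReal.ofReal c * ρ w)
    (hfatou : ∀ (u : ℕ → Ω → ℝ) (v : Ω → ℝ) (K : ℝ≥0∞), K ≠ ∞ →
      (∀ k, Measurable (u k) ∧ 0 ≤ u k) → Monotone u →
      (∀ a, Tendsto (fun k => u k a) atTop (𝓝 (v a))) → (∀ k, ρ (u k) ≤ K) → ρ v ≤ K) :
    ∃ μ : Measure Ω, μ ≪ ν ∧
      (∀ p ∈ D, ∫⁻ a, ENNReal.ofReal (p.1 a) ∂μ ≤ ENNReal.ofReal p.2) ∧
      (∀ v : Ω → ℝ, Measurable v → 0 ≤ v → ρ v ≤ ∫⁻ a, ENNReal.ofReal (v a) ∂μ) := by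
  obtain ⟨L, hL0, hLD, hLρ⟩ := exists_linearMap_between (ν := ν) D ρ hDm hD0 hs0 hDρ hρ
  have h : IsPositiveOn ν (dominatedSubmodule ν D) L :=
    { measurable := fun v hv => hv.1
      solid := by
        rintro v ⟨-, p, hp, hvp⟩ u hu huv
        refine ⟨hu, p, hp, ?_⟩
        filter_upwards [hvp] with a ha using (huv a).trans ha
      mem_of_ae_zero := fun u hu hu0 =>
        ⟨hu, 0, zero_mem D, by filter_upwards [hu0] with a ha; simp [ha]⟩
      nonneg := hL0 }
  have hDV : ∀ p ∈ D, p.1 ∈ dominatedSubmodule ν D := fun p hp =>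
    ⟨hDm p hp, p, hp, ae_of_all _ fun a => (abs_of_nonneg (hD0 p hp a)).le⟩
  refine ⟨h.countablyAdditivePart, h.absolutelyContinuous, fun p hp => ?_, fun v hv hv0 => ?_⟩
  · exact (h.lintegral_le (hDV p hp) (hD0 p hp)).trans (ENNReal.ofReal_le_ofReal (hLD p hp))
  by_cases hfin : ∫⁻ a, ENNReal.ofReal (v a) ∂h.countablyAdditivePart = ∞
  · rw [hfin]; exact le_top
  have hsimple : ∀ φ : SimpleFunc Ω ℝ≥0, ∫⁻ a, φ a ∂h.countablyAdditivePart ≠ ∞ →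
      ρ (fun a => (φ a : ℝ)) ≤ ∫⁻ a, φ a ∂h.countablyAdditivePart := by
    intro φ hφ
    -- Any purely finitely additive excess of `L` is discarded here: `ρ ≤ L` is used only on the
    -- approximants, and the Fatou property carries the bound to `φ`.
    refine ENNReal.le_of_forall_pos_le_add fun ε hε _ => ?_
    obtain ⟨u, hum, hut, hu⟩ := h.exists_approx φ hφ ε (by exact_mod_cast hε.ne')
    exact hfatou u _ _ (ENNReal.add_ne_top.2 ⟨hφ, ENNReal.coe_ne_top⟩)
      (fun k => ⟨h.measurable _ (hu k).1, (hu k).2.1⟩) hum hut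
      fun k => (hLρ _ (hu k).1 (hu k).2.1).trans (hu k).2.2
  have hm : Measurable fun a => ENNReal.ofReal (v a) := hv.ennreal_ofReal
  let φ : ℕ → SimpleFunc Ω ℝ≥0 := fun n =>
    (SimpleFunc.eapprox (fun a => ENNReal.ofReal (v a)) n).map ENNReal.toNNReal
  have hφ : ∀ n a, (φ n a : ℝ≥0∞) = SimpleFunc.eapprox (fun a => ENNReal.ofReal (v a)) n a :=
    fun n a => ENNReal.coe_toNNReal (SimpleFunc.eapprox_lt_top _ n a).ne
  have hle : ∀ n, ∫⁻ a, φ n a ∂h.countablyAdditivePart ≤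
      ∫⁻ a, ENNReal.ofReal (v a) ∂h.countablyAdditivePart := by
    intro n
    refine lintegral_mono fun a => ?_
    simp only [hφ]
    rw [← SimpleFunc.iSup_eapprox_apply hm a]
    exact le_iSup (fun n => SimpleFunc.eapprox (fun a => ENNReal.ofReal (v a)) n a) n
  have hmono : Monotone fun n a => ((φ n a : ℝ≥0) : ℝ) := by
    intro m n hmn a
    have h1 := SimpleFunc.monotone_eapprox (fun a => ENNReal.ofReal (v a)) hmn a
    rw [← hφ, ← hφ, ENNReal.coe_le_coe] at h1
    exact h1
  refine hfatou (fun n a => (φ n a : ℝ)) v _ hfin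
    (fun n => ⟨(φ n).measurable.coe_nnreal_real, fun a => (φ n a).2⟩) hmono (fun a => ?_)
    fun n => (hsimple _ (ne_top_of_le_ne_top hfin (hle n))).trans (hle n)
  have h1 : Tendsto (fun n => (φ n a : ℝ≥0∞)) atTop (𝓝 (ENNReal.ofReal (v a))) := by
    simp only [hφ]
    rw [← SimpleFunc.iSup_eapprox_apply hm a]
    exact tendsto_atTop_iSup fun m n hmn => SimpleFunc.monotone_eapprox _ hmn a
  have h2 := (ENNReal.tendsto_toReal ENNReal.ofReal_ne_top).comp h1
  simpa [Function.comp_def, ENNReal.toReal_ofReal (hv0 a)] using h2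

end CountablyAdditivePart

/-! ### The `r`-th power functional on `Y`: homogeneity, superadditivity up to a constant, Fatou
property. -/

namespace QuasiKotheSpace

variable {Ω : Type*} [MeasurableSpace Ω] {μ : Measure Ω} (Y : QuasiKotheSpace μ)

theorem extNorm_of_ae_eq {f : Ω → ℝ} (x : Y.carrier) (h : ⇑(x : Ω →ₘ[μ] ℝ) =ᵐ[μ] f) :
    extNorm Y.qnorm f = ENNReal.ofReal (Y.qnorm x) := by
  refine le_antisymm (iInf₂_le x h) (le_iInf₂ fun x' h' => ?_)
  have : x' = x := Subtype.ext (AEEqFun.ext (h'.trans h.symm))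
  rw [this]

theorem extNorm_coe (x : Y.carrier) :
    extNorm Y.qnorm (x : Ω →ₘ[μ] ℝ) = ENNReal.ofReal (Y.qnorm x) :=
  Y.extNorm_of_ae_eq x EventuallyEq.rfl

theorem exists_of_extNorm_ne_top {f : Ω → ℝ} (h : extNorm Y.qnorm f ≠ ∞) :
    ∃ x : Y.carrier, ⇑(x : Ω →ₘ[μ] ℝ) =ᵐ[μ] f := by
  by_contra! hx
  exact h (iInf₂_eq_top.2 fun x hx' => absurd hx' (hx x))

theorem extNorm_mono {f g : Ω → ℝ} (hf : AEStronglyMeasurable f μ) (hfg : ∀ᵐ a ∂μ, |f a| ≤ |g a|) :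
    extNorm Y.qnorm f ≤ extNorm Y.qnorm g := by
  refine le_iInf₂ fun x hx => ?_
  obtain ⟨hm, hle⟩ := Y.solid (AEEqFun.mk f hf) x (by
    rw [← AEEqFun.coeFn_le]
    filter_upwards [AEEqFun.coeFn_abs (AEEqFun.mk f hf), AEEqFun.coeFn_abs (x : Ω →ₘ[μ] ℝ),
      AEEqFun.coeFn_mk f hf, hx, hfg] with a h1 h2 h3 h4 h5
    rw [h1, h2, h3, h4]
    exact h5)
  rw [Y.extNorm_of_ae_eq ⟨_, hm⟩ (AEEqFun.coeFn_mk f hf)]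
  exact ENNReal.ofReal_le_ofReal hle

theorem extNorm_eq_zero {f : Ω → ℝ} (h : extNorm Y.qnorm f = 0) : f =ᵐ[μ] 0 := by
  obtain ⟨x, hx⟩ := Y.exists_of_extNorm_ne_top (h.trans_ne ENNReal.zero_ne_top)
  rw [Y.extNorm_of_ae_eq x hx, ENNReal.ofReal_eq_zero] at h
  have hx0 : x = 0 := (Y.isQuasiNorm.eq_zero_iff x).1 (le_antisymm h (Y.isQuasiNorm.nonneg x))
  rw [hx0] at hx
  exact hx.symm.trans AEEqFun.coeFn_zero

theorem extNorm_zero : extNorm Y.qnorm (fun _ => 0) = 0 := by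
  rw [Y.extNorm_of_ae_eq (f := fun _ => 0) 0 AEEqFun.coeFn_zero, (Y.isQuasiNorm.eq_zero_iff 0).2 rfl]
  simp

theorem extNorm_const_mul_le (c : ℝ) (f : Ω → ℝ) (hc : c ≠ 0) :
    extNorm Y.qnorm (fun a => c * f a) ≤ ENNReal.ofReal |c| * extNorm Y.qnorm f := by
  by_cases h : extNorm Y.qnorm f = ∞
  · rw [h, ENNReal.mul_top (by simpa using hc)]
    exact le_top
  obtain ⟨x, hx⟩ := Y.exists_of_extNorm_ne_top h
  rw [Y.extNorm_of_ae_eq x hx, Y.extNorm_of_ae_eq (c • x), Y.isQuasiNorm.smul,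
    ENNReal.ofReal_mul (abs_nonneg c)]
  rw [Submodule.coe_smul]
  filter_upwards [AEEqFun.coeFn_smul c (x : Ω →ₘ[μ] ℝ), hx] with a h1 h2
  rw [h1, Pi.smul_apply, h2, smul_eq_mul]

theorem extNorm_const_mul (c : ℝ) (f : Ω → ℝ) :
    extNorm Y.qnorm (fun a => c * f a) = ENNReal.ofReal |c| * extNorm Y.qnorm f := by
  rcases eq_or_ne c 0 with rfl | hc
  · simp [extNorm_zero]
  refine le_antisymm (Y.extNorm_const_mul_le c f hc) ?_
  have h := Y.extNorm_const_mul_le c⁻¹ (fun a => c * f a) (inv_ne_zero hc)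
  simp only [inv_mul_cancel_left₀ hc] at h
  calc _ ≤ ENNReal.ofReal |c| * (ENNReal.ofReal |c⁻¹| * extNorm Y.qnorm fun a => c * f a) := by
        gcongr
    _ = extNorm Y.qnorm fun a => c * f a := by
        rw [← mul_assoc, ← ENNReal.ofReal_mul (abs_nonneg c), ← abs_mul, mul_inv_cancel₀ hc]
        simp

/-- The `r`-th power of the norm of `|f| ^ (1 / r)`. -/
noncomputable def powNorm (r : ℝ) (f : Ω → ℝ) : ℝ≥0∞ :=
  extNorm Y.qnorm (fun a => |f a| ^ (1 / r)) ^ r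

variable {r : ℝ}

theorem powNorm_rpow (hr : 0 < r) (f : Ω → ℝ) :
    Y.powNorm r f ^ (1 / r) = extNorm Y.qnorm (fun a => |f a| ^ (1 / r)) := by
  rw [powNorm, ← ENNReal.rpow_mul, mul_one_div_cancel hr.ne', ENNReal.rpow_one]

theorem powNorm_ne_top_iff (hr : 0 < r) (f : Ω → ℝ) :
    Y.powNorm r f ≠ ∞ ↔ extNorm Y.qnorm (fun a => |f a| ^ (1 / r)) ≠ ∞ := by
  rw [powNorm, ne_eq, ENNReal.rpow_eq_top_iff_of_pos hr]

theorem powNorm_mono (hr : 0 < r) {f g : Ω → ℝ} (hf : Measurable f)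
    (hfg : ∀ᵐ a ∂μ, |f a| ≤ |g a|) : Y.powNorm r f ≤ Y.powNorm r g := by
  refine ENNReal.rpow_le_rpow (Y.extNorm_mono ?_ ?_) hr.le
  · exact (hf.abs.pow_const _).aestronglyMeasurable
  · filter_upwards [hfg] with a ha
    rw [abs_of_nonneg (Real.rpow_nonneg (abs_nonneg (f a)) _),
      abs_of_nonneg (Real.rpow_nonneg (abs_nonneg (g a)) _)]
    exact Real.rpow_le_rpow (abs_nonneg _) ha (by positivity)

theorem powNorm_smul (hr : 0 < r) {c : ℝ} (hc : 0 ≤ c) (f : Ω → ℝ) :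
    Y.powNorm r (c • f) = ENNReal.ofReal c * Y.powNorm r f := by
  have e : (fun a => |(c • f) a| ^ (1 / r)) = fun a => c ^ (1 / r) * |f a| ^ (1 / r) := by
    ext a
    rw [Pi.smul_apply, smul_eq_mul, abs_mul, abs_of_nonneg hc, Real.mul_rpow hc (abs_nonneg _)]
  rw [powNorm, e, extNorm_const_mul, ENNReal.mul_rpow_of_nonneg _ _ hr.le, powNorm,
    abs_of_nonneg (by positivity), ENNReal.ofReal_rpow_of_nonneg (by positivity) hr.le,
    ← Real.rpow_mul hc, one_div_mul_cancel hr.ne', Real.rpow_one]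

/-- Concavity applied to the functions `w k ^ (1 / r)`, which belong to `Y` by solidity because
`powNorm r f` is finite. -/
theorem sum_powNorm_le (hr : 0 < r) {c : ℝ≥0} (hc : Y.ConcaveWith r c) {n : ℕ}
    {w : Fin n → Ω → ℝ} (hw : ∀ k, Measurable (w k)) (hw0 : ∀ k, 0 ≤ w k) {f : Ω → ℝ}
    (hwf : ∀ᵐ a ∂μ, ∑ k, w k a ≤ f a) (hf : Y.powNorm r f ≠ ∞) :
    ∑ k, Y.powNorm r (w k) ≤ (c : ℝ≥0∞) ^ r * Y.powNorm r f := by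
  have hwk : ∀ k, ∀ᵐ a ∂μ, |w k a| ≤ |f a| := fun k => by
    filter_upwards [hwf] with a ha
    rw [abs_of_nonneg (hw0 k a)]
    exact (Finset.single_le_sum (f := fun k => w k a) (fun j _ => hw0 j a)
      (Finset.mem_univ k)).trans (ha.trans (le_abs_self _))
  have hx : ∀ k, ∃ x : Y.carrier, ⇑(x : Ω →ₘ[μ] ℝ) =ᵐ[μ] fun a => |w k a| ^ (1 / r) := fun k =>
    Y.exists_of_extNorm_ne_top ((Y.powNorm_ne_top_iff hr _).1
      (ne_top_of_le_ne_top hf (Y.powNorm_mono hr (hw k) (hwk k))))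
  choose x hx using hx
  have h1 : ∀ k, Y.powNorm r (w k) = ENNReal.ofReal (Y.qnorm (x k) ^ r) := fun k => by
    rw [powNorm, Y.extNorm_of_ae_eq (x k) (hx k),
      ENNReal.ofReal_rpow_of_nonneg (Y.isQuasiNorm.nonneg _) hr.le]
  have hnn : ∀ k, 0 ≤ Y.qnorm (x k) ^ r := fun k => Real.rpow_nonneg (Y.isQuasiNorm.nonneg _) _
  simp only [h1]
  rw [← ENNReal.ofReal_sum_of_nonneg fun k _ => hnn k]
  have h2 := hc n x
  have hS : 0 ≤ ∑ k, Y.qnorm (x k) ^ r := Finset.sum_nonneg fun k _ => hnn k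
  have h3 : ENNReal.ofReal (∑ k, Y.qnorm (x k) ^ r) =
      ENNReal.ofReal ((∑ k, Y.qnorm (x k) ^ r) ^ (1 / r)) ^ r := by
    rw [ENNReal.ofReal_rpow_of_nonneg (by positivity) hr.le, ← Real.rpow_mul hS,
      one_div_mul_cancel hr.ne', Real.rpow_one]
  rw [h3, powNorm, ← ENNReal.mul_rpow_of_nonneg _ _ hr.le]
  refine ENNReal.rpow_le_rpow (h2.trans ?_) hr.le
  gcongr
  refine Y.extNorm_mono ?_ ?_
  · refine AEMeasurable.aestronglyMeasurable ?_
    refine AEMeasurable.pow_const ?_ _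
    exact Finset.aemeasurable_fun_sum _ fun k _ =>
      ((AEEqFun.measurable _).abs.pow_const _).aemeasurable
  · filter_upwards [hwf, ae_all_iff.2 hx] with a ha hxa
    have h4 : ∀ k, |(x k : Ω →ₘ[μ] ℝ) a| ^ r = w k a := fun k => by
      rw [hxa k, abs_of_nonneg (by positivity), ← Real.rpow_mul (abs_nonneg _),
        one_div_mul_cancel hr.ne', Real.rpow_one, abs_of_nonneg (hw0 k a)]
    simp only [h4]
    have h5 : 0 ≤ ∑ k, w k a := Finset.sum_nonneg fun k _ => hw0 k a
    rw [abs_of_nonneg (by positivity), abs_of_nonneg (by positivity)]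
    exact Real.rpow_le_rpow h5 (ha.trans (le_abs_self _)) (by positivity)

/-- In an `r`-concave space, the truncations of `v` to an increasing sequence of sets form a Cauchy
sequence if they are bounded. -/
theorem exists_powNorm_indicator_sdiff_lt (hr : 0 < r) {c : ℝ≥0} (hc : Y.ConcaveWith r c)
    {v : Ω → ℝ} (hv : Measurable v) (hv0 : 0 ≤ v) {C : ℕ → Set Ω} (hCm : ∀ n, MeasurableSet (C n))
    (hC : Monotone C) {K : ℝ≥0∞} (hK : K ≠ ∞) (hvK : ∀ n, Y.powNorm r ((C n).indicator v) ≤ K)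
    {ε : ℝ≥0∞} (hε : ε ≠ 0) :
    ∃ m, ∀ n, m ≤ n → Y.powNorm r ((C n \ C m).indicator v) < ε := by
  by_contra! hcon
  choose f hf hfε using hcon
  -- If the claim fails, iterating the bad index gives infinitely many disjoint pieces of `v`, each
  -- of size at least `ε`. Any `J` of them sum to at most one truncation, so concavity gives `J ε ≤
  -- c^r K` for all `J`.
  let s : ℕ → ℕ := fun k => f^[k] 0
  have hs : ∀ k, s (k + 1) = f (s k) := fun k => Function.iterate_succ_apply' f k 0
  have hCs : Monotone fun k => C (s k) :=
    hC.comp (monotone_nat_of_le_succ fun k => (hs k).symm ▸ hf (s k))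
  have key : ∀ J : ℕ, (J : ℝ≥0∞) * ε ≤ (c : ℝ≥0∞) ^ r * K := by
    intro J
    have h1 := Y.sum_powNorm_le hr hc (n := J)
      (w := fun k => (C (s (k + 1)) \ C (s k)).indicator v)
      (fun k => hv.indicator ((hCm _).diff (hCm _)))
      (fun k => Set.indicator_nonneg fun a _ => hv0 a) (f := (C (s J)).indicator v)
      (ae_of_all _ fun a => ?_) (ne_top_of_le_ne_top hK (hvK _))
    · calc (J : ℝ≥0∞) * ε = ∑ k : Fin J, ε := by simp
        _ ≤ _ := Finset.sum_le_sum fun k _ => by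
              rw [hs]; exact hfε (s k)
        _ ≤ _ := h1
        _ ≤ _ := by gcongr; exact hvK _
    · have e : ∀ k, (C (s (k + 1)) \ C (s k)).indicator v a =
          (C (s (k + 1))).indicator v a - (C (s k)).indicator v a := fun k => by
        rw [Set.indicator_sdiff (hCs (Nat.le_succ k))]; rfl
      rw [Fin.sum_univ_eq_sum_range fun k => (C (s (k + 1)) \ C (s k)).indicator v a]
      simp only [e]
      rw [Finset.sum_range_sub fun k => (C (s k)).indicator v a]
      linarith [Set.indicator_nonneg (s := C (s 0)) (fun a _ => hv0 a) a]
  have hfin : (c : ℝ≥0∞) ^ r * K ≠ ∞ :=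
    ENNReal.mul_ne_top (ENNReal.rpow_ne_top_of_nonneg hr.le ENNReal.coe_ne_top) hK
  obtain ⟨J, hJ⟩ := ENNReal.exists_nat_mul_gt hε hfin
  exact absurd (key J) (not_le.2 hJ)

/-- An `r`-concave quasi Banach function space contains every function which is the limit of an
increasing sequence bounded in the space. -/
theorem powNorm_fatou (hY : Y.IsQuasiBanach) (hr : 0 < r) {c : ℝ≥0} (hc : Y.ConcaveWith r c)
    (u : ℕ → Ω → ℝ) (v : Ω → ℝ) (K : ℝ≥0∞) (hK : K ≠ ∞) (hu : ∀ k, Measurable (u k) ∧ 0 ≤ u k)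
    (hum : Monotone u) (hut : ∀ a, Tendsto (fun k => u k a) atTop (𝓝 (v a)))
    (huK : ∀ k, Y.powNorm r (u k) ≤ K) : Y.powNorm r v ≤ K := by
  have hv : Measurable v := measurable_of_tendsto_metrizable (fun k => (hu k).1)
    (tendsto_pi_nhds.2 hut)
  have huv : ∀ k a, u k a ≤ v a := fun k a =>
    Monotone.ge_of_tendsto (fun m n hmn => hum hmn a) (hut a) k
  have hv0 : 0 ≤ v := fun a => ((hu 0).2 a).trans (huv 0 a)
  have hr' : 0 < 1 / r := by positivity
  -- On `C n` the limit is controlled by `2 u n`. The factor exceeding `1` makes these sets exhaust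
  -- `Ω`: where `v > 0`, eventually `u n > v / 2`.
  let C : ℕ → Set Ω := fun n => {a | v a ≤ 2 * u n a}
  have hCm : ∀ n, MeasurableSet (C n) := fun n => measurableSet_le hv ((hu n).1.const_mul 2)
  have hC : Monotone C := fun m n hmn a (ha : v a ≤ _) =>
    ha.trans (mul_le_mul_of_nonneg_left (hum hmn a) zero_le_two)
  have hCU : ∀ a, ∃ n, a ∈ C n := by
    intro a
    rcases (hv0 a).eq_or_lt with h0 | hpos
    · exact ⟨0, by change v a ≤ _; rw [← h0]; exact mul_nonneg zero_le_two ((hu 0).2 a)⟩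
    · have : ∀ᶠ k in atTop, v a / 2 < u k a := (hut a).eventually_const_lt (half_lt_self hpos)
      obtain ⟨k, hk⟩ := this.exists
      exact ⟨k, by change v a ≤ _; linarith⟩
  have hvK : ∀ n, Y.powNorm r ((C n).indicator v) ≤ ENNReal.ofReal 2 * K := by
    intro n
    calc _ ≤ Y.powNorm r ((2 : ℝ) • u n) := by
          refine Y.powNorm_mono hr (hv.indicator (hCm n)) (ae_of_all _ fun a => ?_)
          rw [Pi.smul_apply, smul_eq_mul, abs_of_nonneg (Set.indicator_nonneg (fun a _ => hv0 a) a),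
            abs_of_nonneg (mul_nonneg zero_le_two ((hu n).2 a))]
          by_cases ha : a ∈ C n
          · rw [Set.indicator_of_mem ha]; exact ha
          · rw [Set.indicator_of_notMem ha]; exact mul_nonneg zero_le_two ((hu n).2 a)
      _ = ENNReal.ofReal 2 * Y.powNorm r (u n) := Y.powNorm_smul hr zero_le_two _
      _ ≤ _ := by gcongr; exact huK n
  have hK2 : ENNReal.ofReal 2 * K ≠ ∞ := ENNReal.mul_ne_top ENNReal.ofReal_ne_top hK
  have hy : ∀ n, ∃ y : Y.carrier,
      ⇑(y : Ω →ₘ[μ] ℝ) =ᵐ[μ] fun a => |(C n).indicator v a| ^ (1 / r) := fun n =>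
    Y.exists_of_extNorm_ne_top ((Y.powNorm_ne_top_iff hr _).1 (ne_top_of_le_ne_top hK2 (hvK n)))
  choose y hy using hy
  have hyd : ∀ m n k, m ≤ n → m ≤ k → n ≤ k → ENNReal.ofReal (Y.qnorm (y n - y k)) ≤
      Y.powNorm r ((C k \ C m).indicator v) ^ (1 / r) := by
    intro m n k hmn hmk hnk
    rw [powNorm_rpow _ hr, ← extNorm_coe]
    refine Y.extNorm_mono (AEEqFun.aestronglyMeasurable _) ?_
    rw [Submodule.coe_sub]
    filter_upwards [hy n, hy k, AEEqFun.coeFn_sub (y n : Ω →ₘ[μ] ℝ) (y k)] with a h1 h2 h3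
    rw [h3, Pi.sub_apply, h1, h2]
    by_cases hk : a ∈ C k
    · by_cases hn : a ∈ C n
      · simp only [hk, hn, Set.indicator_of_mem, sub_self, abs_zero]
        positivity
      · have hm : a ∉ C m := fun h => hn (hC hmn h)
        simp [hk, hn, hm, Real.zero_rpow (inv_pos.2 hr).ne']
    · have hn : a ∉ C n := fun h => hk (hC hnk h)
      simp only [hk, hn, Set.indicator_of_notMem, not_false_eq_true, sub_self, abs_zero]
      positivity
  obtain ⟨z, hz⟩ := hY y (by
    intro ε hε
    obtain ⟨m, hm⟩ := Y.exists_powNorm_indicator_sdiff_lt hr hc hv hv0 hCm hC hK2 hvK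
      (ε := ENNReal.ofReal ε ^ r)
      (by simp only [ne_eq, ENNReal.rpow_eq_zero_iff, ENNReal.ofReal_eq_zero]; simp [hε])
    have hlt : ∀ n k, m ≤ n → n ≤ k → Y.qnorm (y n - y k) < ε := by
      intro n k hn hnk
      rw [← ENNReal.ofReal_lt_ofReal_iff hε]
      refine (hyd m n k hn (hn.trans hnk) hnk).trans_lt ?_
      have := ENNReal.rpow_lt_rpow (hm k (hn.trans hnk)) hr'
      rwa [← ENNReal.rpow_mul, mul_one_div_cancel hr.ne', ENNReal.rpow_one] at this
    refine ⟨m, fun n hn k hk => ?_⟩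
    rcases le_total n k with h | h
    · exact hlt n k hn h
    · have e := Y.isQuasiNorm.smul (-1) (y k - y n)
      rw [neg_smul, one_smul, neg_sub] at e
      rw [e]
      simpa using hlt k n hk h)
  -- On `C m` all later `y n` agree with `v ^ (1 / r)`, so the norm of the difference restricted to
  -- `C m` is below every late `‖y n - z‖`, hence zero. Once the limit is known to lie in `Y`, axiom
  -- (III) gives the sharp constant `K`, without the factor `2`.
  have hzv : ⇑(z : Ω →ₘ[μ] ℝ) =ᵐ[μ] fun a => |v a| ^ (1 / r) := by
    have hm : ∀ m, (C m).indicator (fun a => (z : Ω →ₘ[μ] ℝ) a - |v a| ^ (1 / r)) =ᵐ[μ] 0 := by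
      intro m
      refine Y.extNorm_eq_zero (le_antisymm ?_ zero_le)
      have h0 : Tendsto (fun n => ENNReal.ofReal (Y.qnorm (y n - z))) atTop (𝓝 0) := by
        simpa using ENNReal.tendsto_ofReal hz
      refine ge_of_tendsto h0 ?_
      filter_upwards [eventually_ge_atTop m] with n hmn
      rw [← extNorm_coe]
      refine Y.extNorm_mono ?_ ?_
      · exact (((AEEqFun.measurable _).sub (hv.abs.pow_const _)).indicator
          (hCm m)).aestronglyMeasurable
      · rw [Submodule.coe_sub]
        filter_upwards [hy n, AEEqFun.coeFn_sub (y n : Ω →ₘ[μ] ℝ) z] with a h1 h2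
        rw [h2, Pi.sub_apply, h1]
        by_cases ha : a ∈ C m
        · rw [Set.indicator_of_mem ha, Set.indicator_of_mem (hC hmn ha), abs_sub_comm]
        · rw [Set.indicator_of_notMem ha, abs_zero]; exact abs_nonneg _
    filter_upwards [ae_all_iff.2 hm] with a ha
    obtain ⟨n, hn⟩ := hCU a
    have := ha n
    rw [Set.indicator_of_mem hn] at this
    simpa [sub_eq_zero] using this
  have hx : ∀ n, ∃ x : Y.carrier, ⇑(x : Ω →ₘ[μ] ℝ) =ᵐ[μ] fun a => |u n a| ^ (1 / r) := fun n =>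
    Y.exists_of_extNorm_ne_top ((Y.powNorm_ne_top_iff hr _).1 (ne_top_of_le_ne_top hK (huK n)))
  choose x hx using hx
  have hlim := Y.fatou x z
    (fun n => by
      rw [← AEEqFun.coeFn_le]
      filter_upwards [hx n, AEEqFun.coeFn_zero (α := Ω) (μ := μ) (β := ℝ)] with a h1 h2
      rw [h1, h2]
      exact Real.rpow_nonneg (abs_nonneg _) _)
    (by
      filter_upwards [ae_all_iff.2 hx] with a ha m n hmn
      simp only [ha]
      rw [abs_of_nonneg ((hu m).2 a), abs_of_nonneg ((hu n).2 a)]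
      exact Real.rpow_le_rpow ((hu m).2 a) (hum hmn a) hr'.le)
    (by
      filter_upwards [ae_all_iff.2 hx, hzv] with a ha hza
      simp only [ha, hza]
      exact ((hut a).abs).rpow_const (Or.inr hr'.le))
  have hle : extNorm Y.qnorm (fun a => |v a| ^ (1 / r)) ≤ K ^ (1 / r) := by
    rw [Y.extNorm_of_ae_eq z hzv]
    refine le_of_tendsto (ENNReal.tendsto_ofReal hlim) (Eventually.of_forall fun n => ?_)
    rw [← Y.extNorm_of_ae_eq (x n) (hx n), ← Y.powNorm_rpow hr]
    exact ENNReal.rpow_le_rpow (huK n) hr'.le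
  have := ENNReal.rpow_le_rpow hle hr.le
  rwa [← ENNReal.rpow_mul, one_div_mul_cancel hr.ne', ENNReal.rpow_one] at this

end QuasiKotheSpace

/-- Radon-Nikodym without σ-finiteness of `μ`: off its σ-finite part with respect to `ν`, the
measure `μ` equals `∞ • ν`, so the density is `∞` there. -/
theorem MeasureTheory.Measure.AbsolutelyContinuous.exists_withDensity_eq {Ω : Type*}
    [MeasurableSpace Ω] {μ ν : Measure Ω} [SigmaFinite ν] (h : μ ≪ ν) :
    ∃ φ : Ω → ℝ≥0∞, Measurable φ ∧ μ = ν.withDensity φ := by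
  have hS : MeasurableSet (μ.sigmaFiniteSetWRT ν) := measurableSet_sigmaFiniteSetWRT
  refine ⟨fun a => (μ.restrict (μ.sigmaFiniteSetWRT ν)).rnDeriv ν a +
    (μ.sigmaFiniteSetWRT ν)ᶜ.indicator (fun _ => ∞) a,
    (Measure.measurable_rnDeriv _ _).add (measurable_const.indicator hS.compl), ?_⟩
  have h1 : μ.restrict (μ.sigmaFiniteSetWRT ν) ≪ ν := Measure.restrict_le_self.absolutelyContinuous.trans h
  have e := withDensity_add_left (μ := ν)
    (Measure.measurable_rnDeriv (μ.restrict (μ.sigmaFiniteSetWRT ν)) ν)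
    ((μ.sigmaFiniteSetWRT ν)ᶜ.indicator (fun _ => ∞))
  change μ = ν.withDensity ((μ.restrict (μ.sigmaFiniteSetWRT ν)).rnDeriv ν +
    (μ.sigmaFiniteSetWRT ν)ᶜ.indicator (fun _ => ∞))
  rw [e, withDensity_indicator hS.compl, withDensity_const,
    Measure.withDensity_rnDeriv_eq _ _ h1, ← restrict_compl_sigmaFiniteSetWRT h,
    Measure.restrict_add_restrict_compl hS]

/-! ### Construction of the weight. -/

section Weight

variable {Ω : Type*} [MeasurableSpace Ω] {ν : Measure Ω} {E : Type*} [AddCommGroup E] [Module ℝ E]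

/-- The pairs `(∑ |T (x k)| ^ r, c * ∑ ‖x k‖ ^ r)`. -/
def convexityCone (Y : QuasiKotheSpace ν) (q : E → ℝ) (hq : IsQuasiNorm q) (T : E → Y.carrier)
    (hT : IsHomogeneousOp T) (r : ℝ) (hr : 0 < r) (c : ℝ) : PointedCone ℝ ((Ω → ℝ) × ℝ) where
  carrier := {p | Measurable p.1 ∧ 0 ≤ p.1 ∧ ∃ (n : ℕ) (x : Fin n → E),
    (p.1 =ᵐ[ν] fun a => ∑ k, |(T (x k) : Ω →ₘ[ν] ℝ) a| ^ r) ∧ p.2 = c * ∑ k, q (x k) ^ r}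
  zero_mem' := ⟨measurable_const, le_rfl, 0, Fin.elim0, by simp; rfl, by simp⟩
  add_mem' := by
    rintro p p' ⟨hm, h0, n, x, h1, h2⟩ ⟨hm', h0', n', x', h1', h2'⟩
    refine ⟨hm.add hm', add_nonneg h0 h0', n + n', Fin.append x x', ?_, ?_⟩
    · filter_upwards [h1, h1'] with a ha ha'
      simp [Fin.sum_univ_add, ha, ha']
    · simp [Fin.sum_univ_add, h2, h2', mul_add]
  smul_mem' := by
    rintro ⟨b, hb⟩ p ⟨hm, h0, n, x, h1, h2⟩
    -- Homogeneity of `T` and of `q` lets a scalar `b ≥ 0` be absorbed as `b ^ (1 / r)` into each `x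
    -- k`; addition is concatenation of families. So no linearity of `T` is needed for a cone.
    have hbr : (b ^ (1 / r)) ^ r = b := by
      rw [← Real.rpow_mul hb, one_div_mul_cancel hr.ne', Real.rpow_one]
    have hb' : 0 ≤ b ^ (1 / r) := Real.rpow_nonneg hb _
    refine ⟨hm.const_smul b, smul_nonneg hb h0, n, fun k => b ^ (1 / r) • x k, ?_, ?_⟩
    · have hk : ∀ k, ⇑(T (b ^ (1 / r) • x k) : Ω →ₘ[ν] ℝ) =ᵐ[ν]
          fun a => b ^ (1 / r) * (T (x k) : Ω →ₘ[ν] ℝ) a := fun k => by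
        rw [hT _ _ hb', Submodule.coe_smul]
        filter_upwards [AEEqFun.coeFn_smul (b ^ (1 / r)) (T (x k) : Ω →ₘ[ν] ℝ)] with a ha
        rw [ha]; rfl
      filter_upwards [h1, ae_all_iff.2 hk] with a ha hka
      change b * p.1 a = _
      rw [ha, Finset.mul_sum]
      refine Finset.sum_congr rfl fun k _ => ?_
      rw [hka k, abs_mul, abs_of_nonneg hb', Real.mul_rpow hb' (abs_nonneg _), hbr]
    · change b * p.2 = _
      rw [h2, mul_left_comm, Finset.mul_sum]
      congr 1
      refine Finset.sum_congr rfl fun k _ => ?_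
      rw [hq.smul, abs_of_nonneg hb', Real.mul_rpow hb' (hq.nonneg _), hbr]

theorem qnorm_le_of_concaveWith_of_convexWith (Y : QuasiKotheSpace ν) {q : E → ℝ}
    {T : E → Y.carrier} {r : ℝ} (hr : 0 < r) {c d : ℝ≥0} (hc : OpConvexWith q Y T r c)
    (hd : Y.ConcaveWith r d) (hq : IsQuasiNorm q) (x : E) :
    ENNReal.ofReal (Y.qnorm (T x)) ≤ c * d * ENNReal.ofReal (q x) := by
  have h1 := hd 1 fun _ => T x
  have h2 := hc 1 fun _ => x
  simp only [Finset.univ_unique, Finset.sum_const, Finset.card_singleton, one_smul] at h1 h2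
  rw [← Real.rpow_mul (Y.isQuasiNorm.nonneg _), mul_one_div_cancel hr.ne', Real.rpow_one] at h1
  rw [← Real.rpow_mul (hq.nonneg _), mul_one_div_cancel hr.ne', Real.rpow_one] at h2
  calc _ ≤ _ := h1
    _ ≤ d * (c * ENNReal.ofReal (q x)) := by gcongr
    _ = _ := by ring

/-- There is a measure between the `r`-th power of the norm of `Y` and the upper bounds given by an
`r`-convex mapping. -/
theorem exists_measure_of_concaveWith_of_convexWith (Y : QuasiKotheSpace ν) (hY : Y.IsQuasiBanach)
    {q : E → ℝ} (hq : IsQuasiNorm q) {r : ℝ} (hr : 0 < r) {T : E → Y.carrier}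
    (hT : IsHomogeneousOp T) {c d : ℝ≥0} (hc : OpConvexWith q Y T r c) (hd : Y.ConcaveWith r d) :
    ∃ μ : Measure Ω, μ ≪ ν ∧
      (∀ x, ∫⁻ a, ENNReal.ofReal (|(T x : Ω →ₘ[ν] ℝ) a| ^ r) ∂μ ≤
        ENNReal.ofReal (((c * d : ℝ≥0) : ℝ) ^ r * q x ^ r)) ∧
      (∀ v : Ω → ℝ, Measurable v → 0 ≤ v →
        Y.powNorm r v ≤ ∫⁻ a, ENNReal.ofReal (v a) ∂μ) := by
  have hqs : ∀ (n : ℕ) (x : Fin n → E), 0 ≤ ∑ k, q (x k) ^ r := fun n x =>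
    Finset.sum_nonneg fun k _ => Real.rpow_nonneg (hq.nonneg _) _
  have hcr : (0 : ℝ) ≤ ((c * d : ℝ≥0) : ℝ) ^ r := Real.rpow_nonneg (NNReal.coe_nonneg _) _
  obtain ⟨μ, hμ, h1, h2⟩ := exists_measure_between (ν := ν)
    (convexityCone Y q hq T hT r hr (((c * d : ℝ≥0) : ℝ) ^ r)) (Y.powNorm r)
    (fun p hp => hp.1) (fun p hp => hp.2.1)
    (by
      rintro p ⟨-, -, n, x, -, hp⟩
      rw [hp]
      exact mul_nonneg hcr (hqs n x))
    (by
      rintro p ⟨hm, h0, n, x, hp1, hp2⟩ l hl hlp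
      have hle : Y.powNorm r p.1 ≤ (c : ℝ≥0∞) ^ r * ENNReal.ofReal (∑ k, q (x k) ^ r) := by
        have h3 := ENNReal.rpow_le_rpow (hc n x) hr.le
        rw [ENNReal.mul_rpow_of_nonneg _ _ hr.le, ENNReal.ofReal_rpow_of_nonneg
          (Real.rpow_nonneg (hqs n x) _) hr.le, ← Real.rpow_mul (hqs n x),
          one_div_mul_cancel hr.ne', Real.rpow_one] at h3
        refine le_trans (ENNReal.rpow_le_rpow (Y.extNorm_mono ?_ ?_) hr.le) h3
        · exact (hm.abs.pow_const _).aestronglyMeasurable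
        · filter_upwards [hp1] with a ha
          rw [abs_of_nonneg (h0 a), ha]
      have hfin : Y.powNorm r p.1 ≠ ∞ := ne_top_of_le_ne_top
        (ENNReal.mul_ne_top (ENNReal.rpow_ne_top_of_nonneg hr.le ENNReal.coe_ne_top)
          ENNReal.ofReal_ne_top) hle
      -- Concavity contributes `d^r` and the convexity bound `hle` contributes `c^r`; this is why
      -- the cone carries `(c d)^r`.
      have h4 := Y.sum_powNorm_le hr hd (w := fun k : Fin l.length => l[k])
        (fun k => (hl _ (List.getElem_mem _)).1) (fun k => (hl _ (List.getElem_mem _)).2)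
        (f := p.1) (by
          filter_upwards [hlp] with a ha
          have e : l.sum a = ∑ k : Fin l.length, l[k] a := by
            rw [← Finset.sum_apply]
            exact congrFun (Fin.sum_univ_getElem l).symm a
          rw [← e]; exact ha) hfin
      have e : (l.map (Y.powNorm r)).sum = ∑ k : Fin l.length, Y.powNorm r l[k] :=
        (Fin.sum_univ_fun_getElem l (Y.powNorm r)).symm
      rw [e]
      refine h4.trans ?_
      calc _ ≤ (d : ℝ≥0∞) ^ r * ((c : ℝ≥0∞) ^ r * ENNReal.ofReal (∑ k, q (x k) ^ r)) := by
            gcongr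
        _ = ENNReal.ofReal p.2 := by
            rw [hp2, ENNReal.ofReal_mul hcr, ← ENNReal.ofReal_rpow_of_nonneg
              (NNReal.coe_nonneg _) hr.le, ENNReal.ofReal_coe_nnreal, ENNReal.coe_mul,
              ENNReal.mul_rpow_of_nonneg _ _ hr.le]
            ring)
    (fun b w hb _ _ => Y.powNorm_smul hr hb w)
    (Y.powNorm_fatou hY hr hd)
  refine ⟨μ, hμ, fun x => ?_, h2⟩
  refine h1 (fun a => |(T x : Ω →ₘ[ν] ℝ) a| ^ r, ((c * d : ℝ≥0) : ℝ) ^ r * q x ^ r)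
    ⟨(AEEqFun.measurable _).abs.pow_const _, fun a => Real.rpow_nonneg (abs_nonneg _) _, 1,
      fun _ => x, ?_, ?_⟩ <;> simp

/-- The hypothesis makes every member of `Y` vanish a.e. on `{φ = 0}`, so full support makes this
set null. -/
theorem QuasiKotheSpace.ae_ne_zero_of_powNorm_le (Y : QuasiKotheSpace ν) {r : ℝ} (hr : 0 < r)
    {φ : Ω → ℝ≥0∞} (hφ : Measurable φ)
    (h : ∀ v : Ω → ℝ, Measurable v → 0 ≤ v →
      Y.powNorm r v ≤ ∫⁻ a, ENNReal.ofReal (v a) ∂(ν.withDensity φ)) : ∀ᵐ a ∂ν, φ a ≠ 0 := by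
  have hA : MeasurableSet {a | φ a = 0} := hφ (measurableSet_singleton 0)
  refine Y.full_support {a | φ a ≠ 0} hA.compl fun x => ?_
  have hm : Measurable fun a => |(x : Ω →ₘ[ν] ℝ) a| ^ r := (AEEqFun.measurable _).abs.pow_const _
  have h0 := h ({a | φ a = 0}.indicator fun a => |(x : Ω →ₘ[ν] ℝ) a| ^ r) (hm.indicator hA)
    (Set.indicator_nonneg fun a _ => Real.rpow_nonneg (abs_nonneg _) _)
  rw [lintegral_withDensity_eq_lintegral_mul _ hφ (hm.indicator hA).ennreal_ofReal] at h0
  have e : ∀ a, (φ * fun a => ENNReal.ofReal ({a | φ a = 0}.indicator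
      (fun a => |(x : Ω →ₘ[ν] ℝ) a| ^ r) a)) a = 0 := by
    intro a
    by_cases ha : φ a = 0 <;> simp [ha]
  simp only [e, lintegral_zero, nonpos_iff_eq_zero, QuasiKotheSpace.powNorm,
    ENNReal.rpow_eq_zero_iff_of_pos hr] at h0
  filter_upwards [Y.extNorm_eq_zero h0] with a ha hxa hφa
  have hφa' : φ a = 0 := hφa
  have hpos : 0 < |(x : Ω →ₘ[ν] ℝ) a| ^ r := Real.rpow_pos_of_pos (abs_pos.2 hxa) _
  rw [Set.indicator_of_mem (by exact hφa'), Pi.zero_apply, abs_of_pos hpos] at ha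
  exact (Real.rpow_pos_of_pos hpos _).ne' ha

/-- The weighted factorization inequalities with given constants of convexity and concavity. -/
theorem exists_weight [SigmaFinite ν] (Y : QuasiKotheSpace ν) (hY : Y.IsQuasiBanach)
    {q : E → ℝ} (hq : IsQuasiNorm q) {r : ℝ} (hr : 0 < r) {T : E → Y.carrier}
    (hT : IsHomogeneousOp T) {c d : ℝ≥0} (hc : OpConvexWith q Y T r c) (hd : Y.ConcaveWith r d) :
    ∃ w : Ω →ₘ[ν] ℝ, 0 ≤ w ∧
      (∀ y : Ω →ₘ[ν] ℝ, extNorm Y.qnorm (fun a => w a ^ (1 / r) * y a) ≤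
        (c * d : ℝ≥0) * eLpNorm y (ENNReal.ofReal r) ν) ∧
      ∀ x : E,
        (∫⁻ a, ENNReal.ofReal (|(T x : Ω →ₘ[ν] ℝ) a| ^ r) / ENNReal.ofReal (w a) ∂ν) ^ (1 / r) ≤
          ENNReal.ofReal (q x) := by
  have hr' : 0 < 1 / r := by positivity
  -- If `c d = 0` then `T = 0` and the zero weight works; otherwise `(c d)^r` can be inverted.
  rcases eq_or_ne (c * d) 0 with hcd | hcd
  · refine ⟨0, le_rfl, fun y => ?_, fun x => ?_⟩
    · have h0 : (fun a => (0 : Ω →ₘ[ν] ℝ) a ^ (1 / r) * y a) =ᵐ[ν] fun _ => 0 := by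
        filter_upwards [AEEqFun.coeFn_zero (α := Ω) (μ := ν) (β := ℝ)] with a ha
        rw [ha, Pi.zero_apply, Real.zero_rpow hr'.ne', zero_mul]
      rw [Y.extNorm_of_ae_eq 0 (AEEqFun.coeFn_zero.trans h0.symm),
        (Y.isQuasiNorm.eq_zero_iff 0).2 rfl]
      simp
    · have h0 := qnorm_le_of_concaveWith_of_convexWith Y hr hc hd hq x
      rw [← ENNReal.coe_mul, hcd, ENNReal.coe_zero, zero_mul, ← Y.extNorm_coe] at h0
      have h1 := Y.extNorm_eq_zero (le_antisymm h0 zero_le)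
      rw [lintegral_congr_ae (g := fun _ => 0), lintegral_zero, ENNReal.zero_rpow_of_pos hr']
      · exact zero_le
      · filter_upwards [h1] with a ha
        simp [ha, Real.zero_rpow hr.ne']
  obtain ⟨μ, hμ, h1, h2⟩ := exists_measure_of_concaveWith_of_convexWith Y hY hq hr hT hc hd
  obtain ⟨φ, hφ, rfl⟩ := hμ.exists_withDensity_eq
  have hpos := Y.ae_ne_zero_of_powNorm_le hr hφ h2
  set C : ℝ≥0∞ := ((c * d : ℝ≥0) : ℝ≥0∞) ^ r with hC
  have hcd' : ((c * d : ℝ≥0) : ℝ≥0∞) ≠ 0 := by exact_mod_cast hcd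
  have hC0 : C ≠ 0 := (ENNReal.rpow_pos (pos_iff_ne_zero.2 hcd') ENNReal.coe_ne_top).ne'
  have hCt : C ≠ ∞ := ENNReal.rpow_ne_top_of_nonneg hr.le ENNReal.coe_ne_top
  have hCr : C ^ (1 / r) = (c * d : ℝ≥0) := by
    rw [hC, ← ENNReal.rpow_mul, mul_one_div_cancel hr.ne', ENNReal.rpow_one]
  -- The weight `C / φ` is finite a.e. since `φ ≠ 0` a.e., and it is `0` where `φ = ∞`.
  have hwm : Measurable fun a => ((φ a)⁻¹ * C).toReal := (hφ.inv.mul_const C).ennreal_toReal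
  have hw := AEEqFun.coeFn_mk _ (hwm.aestronglyMeasurable (μ := ν))
  have hw0 : ∀ a, 0 ≤ ((φ a)⁻¹ * C).toReal := fun a => ENNReal.toReal_nonneg
  refine ⟨AEEqFun.mk _ hwm.aestronglyMeasurable, ?_, fun y => ?_, fun x => ?_⟩
  · rw [← AEEqFun.coeFn_le]
    filter_upwards [hw, AEEqFun.coeFn_zero (α := Ω) (μ := ν) (β := ℝ)] with a ha h0
    rw [ha, h0]
    exact hw0 a
  · have hvm : Measurable fun a => ((φ a)⁻¹ * C).toReal * |y a| ^ r :=
      hwm.mul (y.measurable.abs.pow_const _)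
    have h3 := h2 _ hvm fun a => mul_nonneg (hw0 a) (Real.rpow_nonneg (abs_nonneg _) _)
    rw [lintegral_withDensity_eq_lintegral_mul _ hφ hvm.ennreal_ofReal] at h3
    have h4 : Y.powNorm r (fun a => ((φ a)⁻¹ * C).toReal * |y a| ^ r) ≤
        C * ∫⁻ a, ‖y a‖ₑ ^ r ∂ν := by
      rw [← lintegral_const_mul' _ _ hCt]
      refine h3.trans (lintegral_mono fun a => ?_)
      rw [Pi.mul_apply, ENNReal.ofReal_mul (hw0 a), ← ENNReal.ofReal_rpow_of_nonneg (abs_nonneg _) hr.le,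
        ← Real.enorm_eq_ofReal_abs, ← mul_assoc]
      gcongr
      calc φ a * ENNReal.ofReal ((φ a)⁻¹ * C).toReal ≤ φ a * ((φ a)⁻¹ * C) := by
            gcongr; exact ENNReal.ofReal_toReal_le
        _ = φ a * (φ a)⁻¹ * C := by rw [mul_assoc]
        _ ≤ 1 * C := by gcongr; exact ENNReal.mul_inv_le_one _
        _ = C := one_mul C
    have h5 := ENNReal.rpow_le_rpow h4 hr'.le
    rw [Y.powNorm_rpow hr, ENNReal.mul_rpow_of_nonneg _ _ hr'.le, hCr] at h5
    rw [eLpNorm_eq_lintegral_rpow_enorm_toReal (by simpa using hr) ENNReal.ofReal_ne_top,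
      ENNReal.toReal_ofReal hr.le]
    refine le_trans (Y.extNorm_mono ?_ ?_) h5
    · exact (((AEEqFun.measurable _).pow_const _).mul y.measurable).aestronglyMeasurable
    · filter_upwards [hw] with a ha
      rw [ha, abs_mul, abs_of_nonneg (Real.rpow_nonneg (hw0 a) _), abs_of_nonneg
        (mul_nonneg (hw0 a) (Real.rpow_nonneg (abs_nonneg _) _)), Real.mul_rpow (hw0 a)
        (Real.rpow_nonneg (abs_nonneg _) _), ← Real.rpow_mul (abs_nonneg _),
        mul_one_div_cancel hr.ne', Real.rpow_one, abs_of_nonneg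
        (mul_nonneg (Real.rpow_nonneg (hw0 a) _) (abs_nonneg _))]
  · have hfm : Measurable fun a => ENNReal.ofReal (|(T x : Ω →ₘ[ν] ℝ) a| ^ r) :=
      ((AEEqFun.measurable _).abs.pow_const _).ennreal_ofReal
    have h3 := h1 x
    rw [lintegral_withDensity_eq_lintegral_mul _ hφ hfm] at h3
    -- Where `φ = ∞` both integrands follow the same convention: `0` if `T x` vanishes, `∞`
    -- otherwise.
    have e : ∫⁻ a, ENNReal.ofReal (|(T x : Ω →ₘ[ν] ℝ) a| ^ r) /
        ENNReal.ofReal (AEEqFun.mk _ (hwm.aestronglyMeasurable (μ := ν)) a) ∂ν =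
        C⁻¹ * ∫⁻ a, (φ * fun a => ENNReal.ofReal (|(T x : Ω →ₘ[ν] ℝ) a| ^ r)) a ∂ν := by
      rw [← lintegral_const_mul' _ _ (ENNReal.inv_ne_top.2 hC0)]
      refine lintegral_congr_ae ?_
      filter_upwards [hw, hpos] with a ha hφa
      rw [ha, ENNReal.ofReal_toReal (ENNReal.mul_ne_top (ENNReal.inv_ne_top.2 hφa) hCt),
        ENNReal.div_eq_inv_mul, ENNReal.mul_inv (Or.inr hCt) (Or.inr hC0), inv_inv, Pi.mul_apply]
      ring
    rw [e]
    have h4 : C⁻¹ * ∫⁻ a, (φ * fun a => ENNReal.ofReal (|(T x : Ω →ₘ[ν] ℝ) a| ^ r)) a ∂ν ≤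
        ENNReal.ofReal (q x) ^ r := by
      calc _ ≤ C⁻¹ * ENNReal.ofReal (((c * d : ℝ≥0) : ℝ) ^ r * q x ^ r) := by gcongr
        _ = C⁻¹ * (C * ENNReal.ofReal (q x) ^ r) := by
          rw [ENNReal.ofReal_mul (Real.rpow_nonneg (NNReal.coe_nonneg _) _),
            ← ENNReal.ofReal_rpow_of_nonneg (NNReal.coe_nonneg _) hr.le, ENNReal.ofReal_coe_nnreal,
            ENNReal.ofReal_rpow_of_nonneg (hq.nonneg _) hr.le]
        _ = _ := by rw [← mul_assoc, ENNReal.inv_mul_cancel hC0 hCt, one_mul]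
    have h5 := ENNReal.rpow_le_rpow h4 hr'.le
    rwa [← ENNReal.rpow_mul, mul_one_div_cancel hr.ne', ENNReal.rpow_one] at h5

end Weight

/-! ### The best constants are attained. -/

section Constants

/-- If `A ≤ c * B` for all `c` satisfying `P`, then `A ≤ (inf P) * B`. -/
theorem le_iInf_mul_of_forall_le {P : ℝ≥0 → Prop} {A B : ℝ≥0∞} (hB : B ≠ ∞)
    (h : ∀ c, P c → A ≤ c * B) (hP : ∃ c, P c) : A ≤ (⨅ (c : ℝ≥0) (_ : P c), (c : ℝ≥0∞)) * B := by
  rcases eq_or_ne B 0 with rfl | hB0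
  · obtain ⟨c, hc⟩ := hP
    simpa using h c hc
  rw [← ENNReal.div_le_iff hB0 hB]
  exact le_iInf₂ fun c hc => (ENNReal.div_le_iff hB0 hB).2 (h c hc)

theorem exists_coe_eq_iInf {P : ℝ≥0 → Prop} (hP : ∃ c, P c) :
    ∃ c : ℝ≥0, (c : ℝ≥0∞) = ⨅ (c : ℝ≥0) (_ : P c), (c : ℝ≥0∞) := by
  obtain ⟨c, hc⟩ := hP
  exact ⟨_, ENNReal.coe_toNNReal (ne_top_of_le_ne_top ENNReal.coe_ne_top (iInf₂_le c hc))⟩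

variable {Ω : Type*} [MeasurableSpace Ω] {ν : Measure Ω}

theorem OpIsConvex.exists_convexWith_eq {E : Type*} {q : E → ℝ} {Y : QuasiKotheSpace ν}
    {T : E → Y.carrier} {r : ℝ} (h : OpIsConvex q Y T r) :
    ∃ c : ℝ≥0, OpConvexWith q Y T r c ∧ (c : ℝ≥0∞) = opConvexityConst q Y T r := by
  obtain ⟨c, hc⟩ := exists_coe_eq_iInf h
  refine ⟨c, fun n x => ?_, hc⟩
  rw [hc]
  exact le_iInf_mul_of_forall_le ENNReal.ofReal_ne_top (fun c hc => hc n x) h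

/-- The infimum passes through the product when the right-hand norm is finite. An infinite norm is a
problem only for best constant `0`, as `0 * ∞ = 0`; one-element families then show that `Y` is
trivial. -/
theorem QuasiKotheSpace.IsConcave.exists_concaveWith_eq {Y : QuasiKotheSpace ν} {r : ℝ}
    (hr : 0 < r) (h : Y.IsConcave r) :
    ∃ c : ℝ≥0, Y.ConcaveWith r c ∧ (c : ℝ≥0∞) = Y.concavityConst r := by
  obtain ⟨c, hc⟩ := exists_coe_eq_iInf h
  have hmain : ∀ (n : ℕ) (x : Fin n → Y.carrier),
      extNorm Y.qnorm (fun a => (∑ k, |(x k : Ω →ₘ[ν] ℝ) a| ^ r) ^ (1 / r)) ≠ ∞ →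
      ENNReal.ofReal ((∑ k, Y.qnorm (x k) ^ r) ^ (1 / r)) ≤
        c * extNorm Y.qnorm (fun a => (∑ k, |(x k : Ω →ₘ[ν] ℝ) a| ^ r) ^ (1 / r)) := by
    intro n x hx
    rw [hc]
    exact le_iInf_mul_of_forall_le hx (fun c hc => hc n x) h
  refine ⟨c, fun n x => ?_, hc⟩
  by_cases hx : extNorm Y.qnorm (fun a => (∑ k, |(x k : Ω →ₘ[ν] ℝ) a| ^ r) ^ (1 / r)) = ∞
  · rcases eq_or_ne c 0 with rfl | hc0
    · have hz : ∀ z : Y.carrier, Y.qnorm z = 0 := fun z => by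
        have e : (fun a => (∑ _k : Fin 1, |(z : Ω →ₘ[ν] ℝ) a| ^ r) ^ (1 / r)) =
            fun a => |(z : Ω →ₘ[ν] ℝ) a| := by
          ext a
          simp only [Finset.univ_unique, Finset.sum_const, Finset.card_singleton, one_smul]
          rw [← Real.rpow_mul (abs_nonneg _), mul_one_div_cancel hr.ne', Real.rpow_one]
        have h1 := hmain 1 (fun _ => z) (by
          rw [e]
          refine ne_top_of_le_ne_top ?_ (Y.extNorm_mono (g := (z : Ω →ₘ[ν] ℝ)) ?_ ?_)
          · rw [Y.extNorm_coe]; exact ENNReal.ofReal_ne_top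
          · exact (AEEqFun.measurable _).abs.aestronglyMeasurable
          · exact ae_of_all _ fun a => (abs_abs _).le)
        simp only [Finset.univ_unique, Finset.sum_const, Finset.card_singleton, one_smul,
          ENNReal.coe_zero, zero_mul, nonpos_iff_eq_zero, ENNReal.ofReal_eq_zero] at h1
        rw [← Real.rpow_mul (Y.isQuasiNorm.nonneg _), mul_one_div_cancel hr.ne',
          Real.rpow_one] at h1
        exact le_antisymm h1 (Y.isQuasiNorm.nonneg z)
      simp [hz, Real.zero_rpow hr.ne', Real.zero_rpow (inv_pos.2 hr).ne']
    · rw [hx, ENNReal.mul_top (by exact_mod_cast hc0)]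
      exact le_top
  · exact hmain n x hx

end Constants

/-! ### Factorization of linear operators through `L_r`. -/

section Factorization

variable {Ω : Type*} [MeasurableSpace Ω] {ν : Measure Ω}

/-- Multiplication by `g` is a bounded linear operator from `L_p` into `Y` if it satisfies the norm
estimate on all measurable functions. -/
theorem exists_mul_linearMap (Y : QuasiKotheSpace ν) {p : ℝ≥0∞} (g : Ω →ₘ[ν] ℝ) (C : ℝ≥0)
    (h : ∀ y : Ω →ₘ[ν] ℝ, extNorm Y.qnorm (g * y : Ω →ₘ[ν] ℝ) ≤ C * eLpNorm y p ν) :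
    ∃ M : Lp ℝ p ν →ₗ[ℝ] Y.carrier,
      (∀ f : Lp ℝ p ν, (M f : Ω →ₘ[ν] ℝ) = g * (f : Ω →ₘ[ν] ℝ)) ∧
      ∀ f : Lp ℝ p ν, Y.qnorm (M f) ≤ C * ‖f‖ := by
  have hmem : ∀ f : Lp ℝ p ν, g * (f : Ω →ₘ[ν] ℝ) ∈ Y.carrier := by
    intro f
    obtain ⟨x, hx⟩ := Y.exists_of_extNorm_ne_top (ne_top_of_le_ne_top
      (ENNReal.mul_ne_top ENNReal.coe_ne_top (Lp.eLpNorm_ne_top f)) (h f))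
    rw [← AEEqFun.ext hx]
    exact x.2
  refine ⟨{ toFun := fun f => ⟨g * (f : Ω →ₘ[ν] ℝ), hmem f⟩
            map_add' := fun f f' => Subtype.ext ?_
            map_smul' := fun c f => Subtype.ext ?_ }, fun f => rfl, fun f => ?_⟩
  · refine AEEqFun.ext ?_
    filter_upwards [AEEqFun.coeFn_mul g ((f + f' : Lp ℝ p ν) : Ω →ₘ[ν] ℝ),
      AEEqFun.coeFn_mul g (f : Ω →ₘ[ν] ℝ), AEEqFun.coeFn_mul g (f' : Ω →ₘ[ν] ℝ), Lp.coeFn_add f f',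
      AEEqFun.coeFn_add (g * (f : Ω →ₘ[ν] ℝ)) (g * (f' : Ω →ₘ[ν] ℝ))] with a h1 h2 h3 h4 h5
    refine h1.trans (Eq.trans ?_ h5.symm)
    rw [Pi.mul_apply, Pi.add_apply, h4, h2, h3]
    simp only [Pi.mul_apply, Pi.add_apply]
    ring
  · refine AEEqFun.ext ?_
    filter_upwards [AEEqFun.coeFn_mul g ((c • f : Lp ℝ p ν) : Ω →ₘ[ν] ℝ),
      AEEqFun.coeFn_mul g (f : Ω →ₘ[ν] ℝ), Lp.coeFn_smul c f,
      AEEqFun.coeFn_smul c (g * (f : Ω →ₘ[ν] ℝ))] with a h1 h2 h3 h4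
    refine h1.trans (Eq.trans ?_ h4.symm)
    rw [Pi.mul_apply, Pi.smul_apply, h3, h2]
    simp only [Pi.mul_apply, Pi.smul_apply, smul_eq_mul]
    ring
  · have h1 := h f
    rw [Y.extNorm_of_ae_eq ⟨_, hmem f⟩ EventuallyEq.rfl] at h1
    have h2 := ENNReal.toReal_mono
      (ENNReal.mul_ne_top ENNReal.coe_ne_top (Lp.eLpNorm_ne_top f)) h1
    rw [ENNReal.toReal_ofReal (Y.isQuasiNorm.nonneg _), ENNReal.toReal_mul] at h2
    exact h2


theorem ae_eq_zero_of_lintegral_div_ne_top {f w : Ω → ℝ} {r : ℝ} (hf : Measurable f)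
    (hw : Measurable w) (h : ∫⁻ a, ENNReal.ofReal (|f a| ^ r) / ENNReal.ofReal (w a) ∂ν ≠ ∞) :
    ∀ᵐ a ∂ν, w a = 0 → f a = 0 := by
  have hm : Measurable fun a => ENNReal.ofReal (|f a| ^ r) / ENNReal.ofReal (w a) :=
    (hf.abs.pow_const _).ennreal_ofReal.div hw.ennreal_ofReal
  filter_upwards [ae_lt_top hm h] with a ha hwa
  by_contra hfa
  rw [hwa, ENNReal.ofReal_zero, ENNReal.div_zero] at ha
  · exact lt_irrefl _ ha
  · rw [ne_eq, ENNReal.ofReal_eq_zero, not_le]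
    exact Real.rpow_pos_of_pos (abs_pos.2 hfa) _

theorem eLpNorm_div_le {f w : Ω → ℝ} {r : ℝ} (hr : 0 < r) (hw : ∀ᵐ a ∂ν, 0 ≤ w a) :
    eLpNorm (fun a => f a / w a ^ (1 / r)) (ENNReal.ofReal r) ν ≤
      (∫⁻ a, ENNReal.ofReal (|f a| ^ r) / ENNReal.ofReal (w a) ∂ν) ^ (1 / r) := by
  rw [eLpNorm_eq_lintegral_rpow_enorm_toReal (by simpa using hr) ENNReal.ofReal_ne_top,
    ENNReal.toReal_ofReal hr.le]
  refine ENNReal.rpow_le_rpow (lintegral_mono_ae ?_) (by positivity)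
  filter_upwards [hw] with a ha
  rcases ha.eq_or_lt with h0 | hpos
  · rw [← h0, Real.zero_rpow (by positivity), div_zero, enorm_zero, ENNReal.zero_rpow_of_pos hr]
    exact zero_le
  · rw [Real.enorm_eq_ofReal_abs, ENNReal.ofReal_rpow_of_nonneg (abs_nonneg _) hr.le,
      ← ENNReal.ofReal_div_of_pos hpos, abs_div, abs_of_nonneg (Real.rpow_nonneg ha _),
      Real.div_rpow (abs_nonneg _) (Real.rpow_nonneg ha _), ← Real.rpow_mul ha,
      one_div_mul_cancel hr.ne', Real.rpow_one]

/-- A linear mapping into `Y` whose values, divided by `g`, are controlled in `L_p` factors through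
`L_p` by multiplication with `g`. -/
theorem exists_linearMap_div (Y : QuasiKotheSpace ν) {E : Type*} [AddCommGroup E] [Module ℝ E]
    {q : E → ℝ} (hq : ∀ x, 0 ≤ q x) {T : E → Y.carrier} (hT : IsLinearMap ℝ T) {p : ℝ≥0∞}
    (g : Ω →ₘ[ν] ℝ)
    (h : ∀ x, eLpNorm (fun a => (T x : Ω →ₘ[ν] ℝ) a / g a) p ν ≤ ENNReal.ofReal (q x))
    (h0 : ∀ x, ∀ᵐ a ∂ν, g a = 0 → (T x : Ω →ₘ[ν] ℝ) a = 0) :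
    ∃ R : E →ₗ[ℝ] Lp ℝ p ν, (∀ x, (T x : Ω →ₘ[ν] ℝ) = g * (R x : Ω →ₘ[ν] ℝ)) ∧
      ∀ x, ‖R x‖ ≤ q x := by
  have hmem : ∀ x, MemLp (fun a => (T x : Ω →ₘ[ν] ℝ) a / g a) p ν := fun x =>
    ⟨((AEEqFun.measurable _).div g.measurable).aestronglyMeasurable,
      (h x).trans_lt ENNReal.ofReal_lt_top⟩
  refine ⟨{ toFun := fun x => (hmem x).toLp _
            map_add' := fun x y => ?_
            map_smul' := fun c x => ?_ }, fun x => ?_, fun x => ?_⟩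
  · rw [← MemLp.toLp_add]
    refine MemLp.toLp_congr _ _ ?_
    rw [hT.map_add, Submodule.coe_add]
    filter_upwards [AEEqFun.coeFn_add (T x : Ω →ₘ[ν] ℝ) (T y)] with a ha
    rw [ha, Pi.add_apply, Pi.add_apply, add_div]
  · rw [RingHom.id_apply, ← MemLp.toLp_const_smul]
    refine MemLp.toLp_congr _ _ ?_
    rw [hT.map_smul, Submodule.coe_smul]
    filter_upwards [AEEqFun.coeFn_smul c (T x : Ω →ₘ[ν] ℝ)] with a ha
    rw [ha, Pi.smul_apply, Pi.smul_apply, smul_eq_mul, smul_eq_mul, mul_div_assoc]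
  · refine AEEqFun.ext ?_
    filter_upwards [AEEqFun.coeFn_mul g ((hmem x).toLp _ : Lp ℝ p ν), (hmem x).coeFn_toLp,
      h0 x] with a h1 h2 h3
    refine Eq.trans ?_ h1.symm
    rw [Pi.mul_apply, h2]
    by_cases hg : g a = 0
    · rw [hg, zero_mul, h3 hg]
    · rw [mul_div_cancel₀ _ hg]
  · change ‖(hmem x).toLp _‖ ≤ q x
    rw [Lp.norm_toLp]
    exact ENNReal.toReal_le_of_le_ofReal (hq x) (h x)

theorem opQuasiNorm_le {E F : Type*} {p : E → ℝ} {q : F → ℝ} {S : E → F} {C : ℝ≥0}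
    (h : ∀ x, q (S x) ≤ C * p x) : opQuasiNorm p q S ≤ C := iInf₂_le C h

end Factorization

theorem corollary2 {Ω : Type*} [MeasurableSpace Ω] (ν : Measure Ω) [SigmaFinite ν]
    [ν.IsComplete] (Y : QuasiKotheSpace ν) (hY : Y.IsQuasiBanach)
    {E : Type*} [AddCommGroup E] [Module ℝ E] (q : E → ℝ) (hq : IsQuasiNorm q)
    (hqc : IsCompleteQuasiNorm q)
    (r : ℝ) (hr : 0 < r) (hYr : Y.IsConcave r)
    (T : E → Y.carrier) (hT : IsHomogeneousOp T) (hTr : OpIsConvex q Y T r) :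
    (∃ w : Ω →ₘ[ν] ℝ, 0 ≤ w ∧
      (⨆ (y : Ω →ₘ[ν] ℝ) (_ : eLpNorm y (ENNReal.ofReal r) ν ≤ 1),
          extNorm Y.qnorm (fun a => w a ^ (1 / r) * y a)) ≤
        opConvexityConst q Y T r * Y.concavityConst r ∧
      ∀ x : E,
        -- division in `[0, ∞]`: `0 / 0 = 0`, and `c / 0 = ∞` for `c > 0`
        (∫⁻ a, ENNReal.ofReal (|(T x : Ω →ₘ[ν] ℝ) a| ^ r) / ENNReal.ofReal (w a) ∂ν) ^ (1 / r) ≤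
          ENNReal.ofReal (q x)) ∧
    (IsLinearMap ℝ T → 1 ≤ r →
      ∃ (g : Ω →ₘ[ν] ℝ) (Mg : Lp ℝ (ENNReal.ofReal r) ν →ₗ[ℝ] Y.carrier)
        (R : E →ₗ[ℝ] Lp ℝ (ENNReal.ofReal r) ν),
        0 ≤ g ∧
        (∀ f : Lp ℝ (ENNReal.ofReal r) ν, (Mg f : Ω →ₘ[ν] ℝ) = g * (f : Ω →ₘ[ν] ℝ)) ∧
        IsBoundedOp (fun f : Lp ℝ (ENNReal.ofReal r) ν => ‖f‖) Y.qnorm Mg ∧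
        IsBoundedOp q (fun f : Lp ℝ (ENNReal.ofReal r) ν => ‖f‖) R ∧
        (∀ x : E, T x = Mg (R x)) ∧
        opQuasiNorm (fun f : Lp ℝ (ENNReal.ofReal r) ν => ‖f‖) Y.qnorm Mg *
            opQuasiNorm q (fun f : Lp ℝ (ENNReal.ofReal r) ν => ‖f‖) R ≤
          opConvexityConst q Y T r * Y.concavityConst r) := by
  obtain ⟨c, hc, hc'⟩ := hTr.exists_convexWith_eq
  obtain ⟨d, hd, hd'⟩ := hYr.exists_concaveWith_eq hr
  obtain ⟨w, hw0, hwY, hwT⟩ := exists_weight Y hY hq hr hT hc hd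
  rw [← hc', ← hd', ← ENNReal.coe_mul]
  refine ⟨⟨w, hw0, iSup₂_le fun y hy => ?_, hwT⟩, fun hTlin _ => ?_⟩
  · calc _ ≤ _ := hwY y
      _ ≤ (c * d : ℝ≥0) * 1 := by gcongr
      _ = _ := mul_one _
  have hw0' : ∀ᵐ a ∂ν, 0 ≤ w a := by
    filter_upwards [AEEqFun.coeFn_le.2 hw0, AEEqFun.coeFn_zero (α := Ω) (μ := ν) (β := ℝ)]
      with a h1 h2
    rwa [h2] at h1
  have hgm : AEStronglyMeasurable (fun a => w a ^ (1 / r)) ν :=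
    (w.measurable.pow_const _).aestronglyMeasurable
  have hg := AEEqFun.coeFn_mk _ hgm
  obtain ⟨M, hM, hMC⟩ := exists_mul_linearMap Y (p := ENNReal.ofReal r) (AEEqFun.mk _ hgm) (c * d)
    (fun y => by
      refine le_trans (Y.extNorm_mono (AEEqFun.aestronglyMeasurable _) ?_) (hwY y)
      filter_upwards [AEEqFun.coeFn_mul (AEEqFun.mk _ hgm) y, hg] with a h1 h2
      rw [h1, Pi.mul_apply, h2])
  obtain ⟨R, hR, hRq⟩ := exists_linearMap_div Y hq.nonneg hTlin (p := ENNReal.ofReal r)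
    (AEEqFun.mk _ hgm)
    (fun x => by
      refine le_trans (le_of_eq (eLpNorm_congr_ae ?_)) ((eLpNorm_div_le hr hw0').trans (hwT x))
      filter_upwards [hg] with a h1
      rw [h1])
    -- Division by zero yields `0`, so recovering `T x` from the quotient requires `T x = 0` where
    -- the weight vanishes. Finiteness of the weighted integral, with `c / 0 = ∞`, provides this.
    (fun x => by
      have hfin : ∫⁻ a, ENNReal.ofReal (|(T x : Ω →ₘ[ν] ℝ) a| ^ r) / ENNReal.ofReal (w a) ∂ν ≠ ∞ :=
        fun h => by
          have h1 := hwT x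
          rw [h, ENNReal.top_rpow_of_pos (by positivity)] at h1
          exact ENNReal.ofReal_ne_top (top_le_iff.1 h1)
      filter_upwards [ae_eq_zero_of_lintegral_div_ne_top (AEEqFun.measurable _) w.measurable hfin,
        hg, hw0'] with a h1 h2 h3 h4
      rw [h2, Real.rpow_eq_zero h3 (by positivity)] at h4
      exact h1 h4)
  -- The weight is normalised so that `R` has norm at most `1` and the multiplication operator
  -- carries the whole constant `c d`.
  have hR1 : ∀ x, ‖R x‖ ≤ (1 : ℝ≥0) * q x := fun x => by simpa using hRq x
  refine ⟨AEEqFun.mk _ hgm, M, R, ?_, hM, ⟨c * d, hMC⟩, ⟨1, hR1⟩, fun x => ?_, ?_⟩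
  · rw [← AEEqFun.coeFn_le]
    filter_upwards [hg, hw0', AEEqFun.coeFn_zero (α := Ω) (μ := ν) (β := ℝ)] with a h1 h2 h3
    rw [h1, h3]
    exact Real.rpow_nonneg h2 _
  · exact Subtype.ext ((hR x).trans (hM (R x)).symm)
  · calc _ ≤ ((c * d : ℝ≥0) : ℝ≥0∞) * ((1 : ℝ≥0) : ℝ≥0∞) :=
          mul_le_mul' (opQuasiNorm_le hMC) (opQuasiNorm_le hR1)
      _ = _ := by simp
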